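/- Let $n\in\{1,2,3\}$, $A>0$, $\gamma>1$, $\lambda>1$, $\mu\ge 0$ and $\overline\rho>0$. For $\varepsilon>0$ consider the compressible isentropic Euler system with time-dependent damping $$\rho_t+\nabla\cdot(\rho u)=0,\qquad (\rho u)_t+\nabla\cdot(\rho u\otimes u)+\nabla p+\frac{\mu\,\rho u}{(1+t)^{\lambda}}=0,\qquad p=A\rho^\gamma,\qquad (t,x)\in(0,T)\times\mathbb R^n,$$ with initial data $\rho(0,x)=\overline\rho+\varepsilon\rho_0(x)$, $u(0,x)=\varepsilon u_0(x)$, where $\rho_0\in C_0^\infty(\mathbb R^n;\mathbb R)$ and $u_0\in C_0^\infty(\mathbb R^n;\mathbb R^n)$. Its lifespan $T_\varepsilon\in[0,\infty]$ is the supremum of the $T$ for which there is a solution $(\rho,u)$, with $\rho\ge0$, that is $C^1$ on $[0,T)\times\mathbb R^n$. Let $$\phi(x)=\frac1{n\omega_n}\int_{\mathbb S^{n-1}}e^{x\cdot\sigma}\,d\sigma\quad(n\ge2),\qquad \phi(x)=\frac{e^x+e^{-x}}2\quad(n=1),$$ where $\omega_n=\pi^{n/2}/\Gamma(\tfrac n2+1)$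 is the volume of the unit ball of $\mathbb R^n$, and suppose that $$\int_{\mathbb R^n}\rho_0\,\phi\,dx>0,\qquad \int_{\mathbb R^n}u_0\cdot\nabla\phi\,dx>0 .$$ Then there are constants $\varepsilon_0>0$ and $C>0$, independent of $\varepsilon$, such that for every $\varepsilon\in(0,\varepsilon_0]$ the system has no global $C^1$ solution (that is, none on $[0,\infty)\times\mathbb R^n$), and $$T_\varepsilon\le C\varepsilon^{-\frac{2}{3-n}}\ \text{ if } n\in\{1,2\},\qquad T_\varepsilon\le \exp\left(C\varepsilon^{-1}\right)\ \text{ if } n=3 .$$ -/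

import Mathlib

open MeasureTheory Set
open scoped ENNReal ContDiff

namespace DampedEuler

/-- The Euclidean space of dimension `n`. -/
abbrev Space (n : ℕ) : Type := EuclideanSpace ℝ (Fin n)

/-- The `j`-th partial derivative of a scalar function on space. -/
noncomputable def partialDeriv {n : ℕ} (j : Fin n) (f : Space n → ℝ) (x : Space n) : ℝ :=
  fderiv ℝ f x (EuclideanSpace.single j 1)

/-- `ω_n = π^(n/2) / Γ(n/2 + 1)`, the volume of the `n`-dimensional unit ball. -/
noncomputable def unitBallVolume (n : ℕ) : ℝ :=
  Real.pi ^ ((n : ℝ) / 2) / Real.Gamma ((n : ℝ) / 2 + 1)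

/-- The Yordanov–Zhang function: `(e^x + e^(-x)) / 2` in dimension one (written `cosh ‖x‖`, the
hyperbolic cosine being even), and otherwise the mean of `σ ↦ e^(x·σ)` over the unit sphere for the
surface measure (`volume.toSphere`, of total mass `n ω_n`). -/
noncomputable def phi (n : ℕ) (x : Space n) : ℝ :=
  if n = 1 then Real.cosh ‖x‖
  else
    1 / (n * unitBallVolume n) *
      ∫ σ : Metric.sphere (0 : Space n) 1,
        Real.exp (inner ℝ x (σ : Space n)) ∂(volume : Measure (Space n)).toSphere

/-- The time interval `[0, T)`, where `T` may be infinite. -/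
def timeInterval (T : ℝ≥0∞) : Set ℝ := {t | 0 ≤ t ∧ ENNReal.ofReal t < T}

/-- `(ρ, u)` is a `C¹` solution on `[0, T) × ℝⁿ` of the compressible isentropic Euler system with
pressure `p(ρ) = A ρ^γ` and damping coefficient `mu / (1 + t)^lam`, issued from the data
`ρ(0) = ρbar + ε ρ₀`, `u(0) = ε u₀`. The values of `ρ` and `u` at times outside `[0, T)` play no
role (apart from the time `0` of the initial condition). -/
structure IsC1Solution {n : ℕ} (A γ mu lam ρbar : ℝ) (ρ₀ : Space n → ℝ) (u₀ : Space n → Space n)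
    (ε : ℝ) (T : ℝ≥0∞) (ρ : ℝ → Space n → ℝ) (u : ℝ → Space n → Space n) : Prop where
  /-- The density is `C¹` up to the initial time. -/
  density_C1 : ContDiffOn ℝ 1 (fun z : ℝ × Space n => ρ z.1 z.2) (timeInterval T ×ˢ univ)
  /-- The velocity is `C¹` up to the initial time. -/
  velocity_C1 : ContDiffOn ℝ 1 (fun z : ℝ × Space n => u z.1 z.2) (timeInterval T ×ˢ univ)
  /-- The density takes its values in the domain `[0, ∞)` of the pressure law `ρ ↦ A ρ^γ`. -/
  density_nonneg : ∀ t ∈ timeInterval T, ∀ x, 0 ≤ ρ t x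
  /-- Initial density. -/
  density_init : ∀ x, ρ 0 x = ρbar + ε * ρ₀ x
  /-- Initial velocity. -/
  velocity_init : ∀ x, u 0 x = ε • u₀ x
  /-- Conservation of mass: `ρ_t + ∇·(ρ u) = 0`. -/
  mass : ∀ t ∈ timeInterval T, 0 < t → ∀ x,
    deriv (fun s => ρ s x) t + ∑ j, partialDeriv j (fun y => ρ t y * u t y j) x = 0
  /-- Momentum equation: `(ρ u)_t + ∇·(ρ u ⊗ u) + ∇p + mu ρ u / (1 + t)^lam = 0`. -/
  momentum : ∀ t ∈ timeInterval T, 0 < t → ∀ x, ∀ i,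
    deriv (fun s => ρ s x * u s x i) t
      + ∑ j, partialDeriv j (fun y => ρ t y * u t y i * u t y j) x
      + partialDeriv i (fun y => A * ρ t y ^ γ) x
      + mu / (1 + t) ^ lam * (ρ t x * u t x i) = 0

/-- The lifespan: the largest `T` (in `[0, ∞]`) such that there is a `C¹` solution on
`[0, T) × ℝⁿ`. -/
noncomputable def lifespan {n : ℕ} (A γ mu lam ρbar : ℝ) (ρ₀ : Space n → ℝ)
    (u₀ : Space n → Space n) (ε : ℝ) : ℝ≥0∞ :=
  sSup {T | ∃ ρ u, IsC1Solution A γ mu lam ρbar ρ₀ u₀ ε T ρ u}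

end DampedEuler

/-! Two facts carry the blow-up.

*Finite speed of propagation* (`IsC1Solution.finite_speed`). Outside the ball of radius `R + c t`,
where `c` is the sound speed of the background density and the data live in the ball of radius `R`,
a `C¹` solution is at rest. Near the state of rest the flux of the relative entropy is at most `σ`
times the entropy for any `σ > c` (`exists_entropy_flux_bound`), so in a backward cone of slope `σ`
the weighted entropy cannot grow. Smallness is available on short time steps by uniform continuity
on the compact cone, and the steps are chained (`rest_in_cone`). No bound at infinity is assumed.

*Weighted averages.* The function `φ` is a superposition of exponentials `e^(x·σ)` with unit `σ`;
hence `Δφ = φ` and its Hessian is nonnegative. For `X = ∫ (ρ - ρbar) φ` and `M = ∫ ρ u · ∇φ` this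
gives `X' = M` and `M' ≥ c² X - a M + ∫ P(ρ) φ`, where `a` is the damping coefficient and `P ≥ 0` is
the nonlinear part of the pressure. By Jensen's inequality on the ball of radius `R + c t`, whose
`φ`-mass is `O((1 + t)^((n-1)/2) e^(c t))` (`isConvexEigenfunction_phi`), the last term is bounded
below by a superlinear function of `X`, quadratic for small arguments.

The integrable damping is removed by an integrating factor, and with `Z = e^(-c t) X` and
`Q = e^(-c t + ∫ a) (M + c X)` there remains the cooperative system `Z' ≥ m Q - 2 c Z`,
`Q' ≥ κ f gain(Z)`, `f = (1 + t)^(-(n-1)/2)`, with data of size `ε`. Comparison with an explicit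
subsolution, a function of `τ = ∫ f`, shows that `τ` stays below `C / ε` (`exists_blowup_const`).
As `τ` is `t`, `2 (√(1 + t) - 1)` or `log (1 + t)` for `n = 1, 2, 3`, the three lifespan bounds
follow. -/

/-! ### Calculus of partial derivatives and of integrals with compact support -/

namespace DampedEuler

open Filter Topology

variable {n : ℕ}

lemma partialDeriv_add {j : Fin n} {f g : Space n → ℝ} {x : Space n}
    (hf : DifferentiableAt ℝ f x) (hg : DifferentiableAt ℝ g x) :
    partialDeriv j (fun y => f y + g y) x = partialDeriv j f x + partialDeriv j g x := by
  simp [partialDeriv, fderiv_fun_add hf hg]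

lemma partialDeriv_mul {j : Fin n} {f g : Space n → ℝ} {x : Space n}
    (hf : DifferentiableAt ℝ f x) (hg : DifferentiableAt ℝ g x) :
    partialDeriv j (fun y => f y * g y) x
      = partialDeriv j f x * g x + f x * partialDeriv j g x := by
  simp [partialDeriv, fderiv_fun_mul hf hg]; ring

lemma partialDeriv_comp {j : Fin n} {F : ℝ → ℝ} {F' : ℝ} {f : Space n → ℝ} {x : Space n}
    (hF : HasDerivAt F F' (f x)) (hf : DifferentiableAt ℝ f x) :
    partialDeriv j (fun y => F (f y)) x = F' * partialDeriv j f x := by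
  have := (hF.comp_hasFDerivAt x hf.hasFDerivAt).fderiv
  simp only [partialDeriv]
  rw [show (fun y => F (f y)) = F ∘ f from rfl, this]
  simp

lemma fderiv_eq_sum_partialDeriv (f : Space n → ℝ) (x v : Space n) :
    fderiv ℝ f x v = ∑ j, v j * partialDeriv j f x := by
  have hv : v = ∑ j, v j • EuclideanSpace.single j (1 : ℝ) := by
    ext i
    simp [Pi.single_apply]
  conv_lhs => rw [hv]
  simp [partialDeriv]

lemma continuous_partialDeriv {f : Space n → ℝ} (hf : ContDiff ℝ 1 f) (j : Fin n) :
    Continuous (partialDeriv j f) :=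
  (hf.continuous_fderiv one_ne_zero).clm_apply continuous_const

lemma hasCompactSupport_partialDeriv {f : Space n → ℝ} (hf : HasCompactSupport f) (j : Fin n) :
    HasCompactSupport (partialDeriv j f) :=
  hf.fderiv_apply (𝕜 := ℝ) _

lemma integral_mul_partialDeriv {f g : Space n → ℝ} (hf : ContDiff ℝ 1 f) (hg : ContDiff ℝ 1 g)
    (hfc : HasCompactSupport f) (j : Fin n) :
    ∫ x, f x * partialDeriv j g x = -∫ x, partialDeriv j f x * g x := by
  refine integral_mul_fderiv_eq_neg_fderiv_mul_of_integrable ?_ ?_ ?_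
    (fun x _ => (hf.differentiable one_ne_zero) x) (fun x _ => (hg.differentiable one_ne_zero) x)
  · exact ((continuous_partialDeriv hf j).mul hg.continuous).integrable_of_hasCompactSupport
      (hasCompactSupport_partialDeriv hfc j).mul_right
  · exact (hf.continuous.mul (continuous_partialDeriv hg j)).integrable_of_hasCompactSupport
      hfc.mul_right
  · exact (hf.continuous.mul hg.continuous).integrable_of_hasCompactSupport hfc.mul_right

lemma integral_partialDeriv_eq_zero {f : Space n → ℝ} (hf : ContDiff ℝ 1 f)
    (hfc : HasCompactSupport f) (j : Fin n) : ∫ x, partialDeriv j f x = 0 := by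
  have h := integral_mul_partialDeriv hf (contDiff_const (c := (1 : ℝ))) hfc j
  have h0 : ∀ x : Space n, partialDeriv j (fun _ : Space n => (1 : ℝ)) x = 0 := fun x => by
    simp [partialDeriv]
  simp only [h0, mul_zero, integral_zero, mul_one] at h
  linarith

/-- Differentiation under the integral sign for a `C¹` integrand whose space support stays in a
fixed compact set. -/
lemma hasDerivAt_integral_of_compact {g : ℝ → Space n → ℝ} {a b : ℝ}
    (hg : ContDiffOn ℝ 1 (fun z : ℝ × Space n => g z.1 z.2) (Ioo a b ×ˢ univ))
    {K : Set (Space n)} (hK : IsCompact K) (hgK : ∀ s ∈ Ioo a b, ∀ x, x ∉ K → g s x = 0)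
    {t : ℝ} (ht : t ∈ Ioo a b) :
    HasDerivAt (fun s => ∫ x, g s x) (∫ x, deriv (fun s => g s x) t) t := by
  have hopen : IsOpen (Ioo a b ×ˢ (univ : Set (Space n))) := isOpen_Ioo.prod isOpen_univ
  set G : ℝ × Space n → ℝ := fun z => g z.1 z.2 with hG
  set D : ℝ × Space n → ℝ := fun z => fderiv ℝ G z (1, 0) with hD
  have hDc : ContinuousOn D (Ioo a b ×ˢ univ) :=
    (hg.continuousOn_fderiv_of_isOpen hopen le_rfl).clm_apply continuousOn_const
  have hder : ∀ s ∈ Ioo a b, ∀ x, HasDerivAt (fun s => g s x) (D (s, x)) s := by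
    intro s hs x
    have h1 : HasFDerivAt G (fderiv ℝ G (s, x)) (s, x) :=
      ((hg.differentiableOn one_ne_zero).differentiableAt
        (hopen.mem_nhds ⟨hs, mem_univ _⟩)).hasFDerivAt
    have h2 : HasDerivAt (fun s : ℝ => (s, x)) ((1 : ℝ), (0 : Space n)) s :=
      (hasDerivAt_id s).prodMk (hasDerivAt_const s x)
    exact h1.comp_hasDerivAt s h2
  obtain ⟨η, hη, hball⟩ := Metric.isOpen_iff.1 isOpen_Ioo t ht
  have hsub : Metric.closedBall t (η / 2) ⊆ Ioo a b :=
    (Metric.closedBall_subset_ball (by linarith)).trans hball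
  have hcont : ∀ s ∈ Ioo a b, Continuous (g s) := fun s hs =>
    hg.continuousOn.comp_continuous (f := fun x => (s, x)) (by fun_prop) (fun x => ⟨hs, mem_univ _⟩)
  have hDcont : ∀ s ∈ Ioo a b, Continuous (fun x => D (s, x)) := fun s hs =>
    hDc.comp_continuous (f := fun x => (s, x)) (by fun_prop) (fun x => ⟨hs, mem_univ _⟩)
  obtain ⟨C, hC⟩ := ((isCompact_closedBall t (η / 2)).prod hK).exists_bound_of_continuousOn
    (hDc.mono (prod_mono hsub (subset_univ K)))
  have hD0 : ∀ s ∈ Ioo a b, ∀ x, x ∉ K → D (s, x) = 0 := by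
    intro s hs x hx
    have h1 : HasDerivAt (fun s => g s x) 0 s :=
      (hasDerivAt_const s (0 : ℝ)).congr_of_eventuallyEq
        (by filter_upwards [isOpen_Ioo.mem_nhds hs] with r hr using hgK r hr x hx)
    exact (hder s hs x).unique h1
  have key := hasDerivAt_integral_of_dominated_loc_of_deriv_le (μ := (volume : Measure (Space n)))
    (F := g) (x₀ := t) (s := Metric.closedBall t (η / 2)) (F' := fun s x => D (s, x))
    (bound := K.indicator fun _ => C)
    (Metric.closedBall_mem_nhds t (by linarith))
    (by filter_upwards [isOpen_Ioo.mem_nhds ht] with s hs using (hcont s hs).aestronglyMeasurable)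
    ((hcont t ht).integrable_of_hasCompactSupport
      (HasCompactSupport.intro hK fun x hx => hgK t ht x hx))
    (hDcont t ht).aestronglyMeasurable
    (Eventually.of_forall fun x s hs => by
      by_cases hx : x ∈ K
      · simpa [hx] using hC (s, x) ⟨hs, hx⟩
      · simp [hx, hD0 s (hsub hs) x hx])
    ((integrable_indicator_iff hK.measurableSet).2
      (integrableOn_const hK.measure_lt_top.ne))
    (Eventually.of_forall fun x s hs => hder s (hsub hs) x)
  have h3 : ∫ x, deriv (fun s => g s x) t = ∫ x, D (t, x) :=
    integral_congr_ae (Eventually.of_forall fun x => (hder t ht x).deriv)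
  rw [h3]
  exact key.2

/-! ### Regularity of solutions on their time interval -/

lemma mem_timeInterval_of_le {T : ℝ≥0∞} {s t : ℝ} (ht : t ∈ timeInterval T) (hs : 0 ≤ s)
    (hst : s ≤ t) : s ∈ timeInterval T :=
  ⟨hs, (ENNReal.ofReal_le_ofReal hst).trans_lt ht.2⟩

lemma exists_gt_mem_timeInterval {T : ℝ≥0∞} {t : ℝ} (ht : t ∈ timeInterval T) :
    ∃ t', t < t' ∧ t' ∈ timeInterval T := by
  obtain ⟨r, h1, h2⟩ := ENNReal.lt_iff_exists_nnreal_btwn.1 ht.2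
  refine ⟨r, ?_, r.2, by simpa using h2⟩
  rwa [← ENNReal.ofReal_coe_nnreal, ENNReal.ofReal_lt_ofReal_iff_of_nonneg ht.1] at h1

lemma Ioo_subset_timeInterval {T : ℝ≥0∞} {t : ℝ} (ht : t ∈ timeInterval T) :
    Ioo 0 t ⊆ timeInterval T := fun _ hs => mem_timeInterval_of_le ht hs.1.le hs.2.le

lemma timeInterval_mem_nhds {T : ℝ≥0∞} {t : ℝ} (ht : t ∈ timeInterval T) (h0 : 0 < t) :
    timeInterval T ∈ 𝓝 t := by
  obtain ⟨t', h1, h2⟩ := exists_gt_mem_timeInterval ht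
  exact mem_of_superset (isOpen_Ioo.mem_nhds ⟨h0, h1⟩) (Ioo_subset_timeInterval h2)

/-- A function that is `C¹` up to the initial time is `C¹` in space at each time, the initial time
included, since space slices lie in the domain. -/
lemma contDiff_slice {F : Type*} [NormedAddCommGroup F] [NormedSpace ℝ F] {T : ℝ≥0∞}
    {g : ℝ → Space n → F}
    (hg : ContDiffOn ℝ 1 (fun z : ℝ × Space n => g z.1 z.2) (timeInterval T ×ˢ univ))
    {t : ℝ} (ht : t ∈ timeInterval T) : ContDiff ℝ 1 (g t) := by
  have h : ContDiff ℝ 1 (fun x : Space n => (t, x)) := by fun_prop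
  exact contDiffOn_univ.1 (hg.comp h.contDiffOn (fun x _ => ⟨ht, mem_univ _⟩))

lemma contDiffAt_of_mem_timeInterval {F : Type*} [NormedAddCommGroup F] [NormedSpace ℝ F]
    {T : ℝ≥0∞} {g : ℝ → Space n → F}
    (hg : ContDiffOn ℝ 1 (fun z : ℝ × Space n => g z.1 z.2) (timeInterval T ×ˢ univ))
    {t : ℝ} (ht : t ∈ timeInterval T) (h0 : 0 < t) (x : Space n) :
    ContDiffAt ℝ 1 (fun z : ℝ × Space n => g z.1 z.2) (t, x) :=
  hg.contDiffAt (prod_mem_nhds (timeInterval_mem_nhds ht h0) univ_mem)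

lemma differentiableAt_time {F : Type*} [NormedAddCommGroup F] [NormedSpace ℝ F]
    {T : ℝ≥0∞} {g : ℝ → Space n → F}
    (hg : ContDiffOn ℝ 1 (fun z : ℝ × Space n => g z.1 z.2) (timeInterval T ×ˢ univ))
    {t : ℝ} (ht : t ∈ timeInterval T) (h0 : 0 < t) (x : Space n) :
    DifferentiableAt ℝ (fun s => g s x) t := by
  have h1 := (contDiffAt_of_mem_timeInterval hg ht h0 x).differentiableAt one_ne_zero
  have h2 : DifferentiableAt ℝ (fun s : ℝ => (s, x)) t := by fun_prop
  exact DifferentiableAt.comp (f := fun s : ℝ => (s, x)) t h1 h2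

end DampedEuler

/-! ### The pressure law and the relative entropy -/

namespace DampedEuler

open Filter Topology

/-- The nonlinear part `p(ρ) - p(ρbar) - p'(ρbar) (ρ - ρbar)` of the pressure `p(ρ) = A ρ^γ` at
the background density. -/
noncomputable def pressureExcess (A γ ρbar ρ : ℝ) : ℝ :=
  A * ρ ^ γ - A * ρbar ^ γ - A * γ * ρbar ^ (γ - 1) * (ρ - ρbar)

/-- The potential part of the entropy relative to the state of rest of density `ρbar`; for a power
law it is the pressure excess divided by `γ - 1`. -/
noncomputable def relEntropy (A γ ρbar ρ : ℝ) : ℝ := pressureExcess A γ ρbar ρ / (γ - 1)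

variable {A γ ρbar : ℝ}

@[simp] lemma pressureExcess_self : pressureExcess A γ ρbar ρbar = 0 := by simp [pressureExcess]

@[simp] lemma relEntropy_self : relEntropy A γ ρbar ρbar = 0 := by simp [relEntropy]

lemma hasDerivAt_pressure (hγ : 1 < γ) (ρ : ℝ) :
    HasDerivAt (fun ρ => A * ρ ^ γ) (A * γ * ρ ^ (γ - 1)) ρ := by
  have := (Real.hasDerivAt_rpow_const (x := ρ) (p := γ) (Or.inr hγ.le)).const_mul A
  simpa [mul_assoc] using this

lemma hasDerivAt_pressureExcess (hγ : 1 < γ) (ρ : ℝ) :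
    HasDerivAt (pressureExcess A γ ρbar)
      (A * γ * ρ ^ (γ - 1) - A * γ * ρbar ^ (γ - 1)) ρ := by
  have h := ((hasDerivAt_pressure (A := A) hγ ρ).sub_const (A * ρbar ^ γ)).sub
    (((hasDerivAt_id ρ).sub_const ρbar).const_mul (A * γ * ρbar ^ (γ - 1)))
  rw [mul_one] at h
  exact h

lemma hasDerivAt_relEntropy (hγ : 1 < γ) (ρ : ℝ) :
    HasDerivAt (relEntropy A γ ρbar)
      ((A * γ * ρ ^ (γ - 1) - A * γ * ρbar ^ (γ - 1)) / (γ - 1)) ρ :=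
  (hasDerivAt_pressureExcess hγ ρ).div_const _

lemma contDiff_pressure (hγ : 1 < γ) : ContDiff ℝ 1 (fun ρ : ℝ => A * ρ ^ γ) :=
  contDiff_const.mul (Real.contDiff_rpow_const_of_le (n := 1) (by simpa using hγ.le))

lemma contDiff_pressureExcess (hγ : 1 < γ) : ContDiff ℝ 1 (pressureExcess A γ ρbar) := by
  unfold pressureExcess
  exact ((contDiff_pressure hγ).sub contDiff_const).sub (by fun_prop)

lemma contDiff_relEntropy (hγ : 1 < γ) : ContDiff ℝ 1 (relEntropy A γ ρbar) :=
  (contDiff_pressureExcess hγ).div_const _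

/-- The Gibbs relation between the entropy and the pressure. -/
lemma mul_deriv_relEntropy (hγ : 1 < γ) (hρbar : 0 < ρbar) {ρ : ℝ} (hρ : 0 ≤ ρ) :
    ρ * ((A * γ * ρ ^ (γ - 1) - A * γ * ρbar ^ (γ - 1)) / (γ - 1))
      = relEntropy A γ ρbar ρ + (A * ρ ^ γ - A * ρbar ^ γ) := by
  have h1 : ρ * ρ ^ (γ - 1) = ρ ^ γ := by
    rw [mul_comm, ← Real.rpow_add_one' hρ (by linarith)]; ring_nf
  have h2 : ρbar ^ γ = ρbar * ρbar ^ (γ - 1) := by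
    rw [mul_comm, ← Real.rpow_add_one' hρbar.le (by linarith)]; ring_nf
  have h3 : γ - 1 ≠ 0 := by linarith
  rw [relEntropy, pressureExcess, h2, ← h1]
  field_simp
  ring

/-- Convexity of the pressure excess: its graph lies above its tangents. -/
lemma tangent_le_pressureExcess (hA : 0 < A) (hγ : 1 < γ) {a ρ : ℝ} (ha : 0 < a) (hρ : 0 ≤ ρ) :
    pressureExcess A γ ρbar a + (A * γ * a ^ (γ - 1) - A * γ * ρbar ^ (γ - 1)) * (ρ - a)
      ≤ pressureExcess A γ ρbar ρ := by
  have h := one_add_mul_self_le_rpow_one_add (s := ρ / a - 1)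
    (by have : 0 ≤ ρ / a := by positivity
        linarith) hγ.le
  rw [show 1 + (ρ / a - 1) = ρ / a by ring, Real.div_rpow hρ ha.le,
    le_div_iff₀ (Real.rpow_pos_of_pos ha _)] at h
  have h2 : a ^ γ = a ^ (γ - 1) * a := by
    rw [← Real.rpow_add_one' ha.le (by linarith)]; ring_nf
  have h3 : a ^ γ + γ * a ^ (γ - 1) * (ρ - a) ≤ ρ ^ γ := by
    refine le_trans (le_of_eq ?_) h
    rw [h2]; field_simp
  unfold pressureExcess
  nlinarith [mul_le_mul_of_nonneg_left h3 hA.le]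

/-- The concave power `w ↦ (1 + w)^(1/k)` exceeds `1` by a multiple of `min w (w^(1/k))`. -/
lemma one_add_min_le_rpow {k : ℕ} (hk : 1 ≤ k) {w : ℝ} (hw : 0 ≤ w) :
    1 + (2 ^ k)⁻¹ * min w (w ^ (1 / k : ℝ)) ≤ (1 + w) ^ (1 / k : ℝ) := by
  have hk0 : k ≠ 0 := by omega
  set m := min w (w ^ (1 / k : ℝ)) with hm
  have hm0 : 0 ≤ m := le_min hw (Real.rpow_nonneg hw _)
  have hmw : m ≤ w := min_le_left _ _
  have hmk : m ^ k ≤ w := by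
    calc m ^ k ≤ (w ^ (1 / k : ℝ)) ^ k := pow_le_pow_left₀ hm0 (min_le_right _ _) k
      _ = w := by rw [one_div, Real.rpow_inv_natCast_pow hw hk0]
  have h2 : (0 : ℝ) < 2 ^ k := by positivity
  have hy0 : 0 ≤ (2 ^ k)⁻¹ * m := by positivity
  -- expand the power; each of the at most `2 ^ k` non-constant terms is at most `w / 2 ^ k`
  have hmain : (1 + (2 ^ k)⁻¹ * m) ^ k ≤ 1 + w := by
    rw [add_comm 1 ((2 ^ k)⁻¹ * m), add_pow, Finset.sum_range_succ']
    simp only [one_pow, mul_one, pow_zero, Nat.choose_zero_right, Nat.cast_one]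
    have hterm : ∀ i ∈ Finset.range k, ((2 ^ k)⁻¹ * m) ^ (i + 1) * (k.choose (i + 1) : ℝ)
        ≤ ((2 ^ k)⁻¹ * w) * (k.choose (i + 1) : ℝ) := by
      intro i hi
      have hik : i + 1 ≤ k := by have := Finset.mem_range.1 hi; omega
      refine mul_le_mul_of_nonneg_right ?_ (by positivity)
      rw [mul_pow]
      have ha : ((2 ^ k : ℝ)⁻¹) ^ (i + 1) ≤ (2 ^ k)⁻¹ :=
        pow_le_of_le_one (by positivity) (inv_le_one_of_one_le₀ (one_le_pow₀ (by norm_num)))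
          (by omega)
      have hb : m ^ (i + 1) ≤ w := by
        rcases le_total m 1 with h | h
        · exact (pow_le_of_le_one hm0 h (by omega)).trans hmw
        · exact (pow_le_pow_right₀ h hik).trans hmk
      exact mul_le_mul ha hb (by positivity) (by positivity)
    have hsum : ∑ i ∈ Finset.range k, (k.choose (i + 1) : ℝ) ≤ 2 ^ k := by
      have := Nat.sum_range_choose k
      rw [Finset.sum_range_succ'] at this
      have h3 : ∑ i ∈ Finset.range k, k.choose (i + 1) ≤ 2 ^ k := by omega
      exact_mod_cast h3
    have := Finset.sum_le_sum hterm
    rw [← Finset.mul_sum] at this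
    have h4 : (2 ^ k)⁻¹ * w * ∑ i ∈ Finset.range k, (k.choose (i + 1) : ℝ) ≤ w := by
      calc _ ≤ (2 ^ k)⁻¹ * w * 2 ^ k := mul_le_mul_of_nonneg_left hsum (by positivity)
        _ = w := by field_simp
    linarith
  rw [one_div]
  exact (Real.le_rpow_inv_iff_of_pos (by positivity) (by linarith)
    (by exact_mod_cast Nat.pos_of_ne_zero hk0)).2 (by rw [Real.rpow_natCast]; exact hmain)

/-- The gain of the nonlinearity. It is quadratic for small `s` and superlinear for large `s`; the
exponent `1 + 1 / k` covers pressure laws with `γ < 2`. -/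
noncomputable def gain (k : ℕ) (s : ℝ) : ℝ := s * min s (s ^ (1 / k : ℝ))

lemma gain_nonneg (k : ℕ) {s : ℝ} (hs : 0 ≤ s) : 0 ≤ gain k s :=
  mul_nonneg hs (le_min hs (Real.rpow_nonneg hs _))

lemma gain_mono (k : ℕ) {s t : ℝ} (hs : 0 ≤ s) (hst : s ≤ t) : gain k s ≤ gain k t :=
  mul_le_mul hst (min_le_min hst (Real.rpow_le_rpow hs hst (by positivity)))
    (le_min hs (Real.rpow_nonneg hs _)) (hs.trans hst)

/-- Scaling by `κ ∈ [0, 1]` costs at most two powers of `κ`. -/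
lemma sq_mul_gain_le {k : ℕ} (hk : 1 ≤ k) {κ s : ℝ} (hκ : 0 ≤ κ) (hκ1 : κ ≤ 1) (hs : 0 ≤ s) :
    κ ^ 2 * gain k s ≤ gain k (κ * s) := by
  have h1 : κ ≤ κ ^ (1 / k : ℝ) := by
    rcases hκ.eq_or_lt with rfl | hpos
    · positivity
    · have hk1 : (1 : ℝ) ≤ k := by exact_mod_cast hk
      conv_lhs => rw [← Real.rpow_one κ]
      exact Real.rpow_le_rpow_of_exponent_ge hpos hκ1 (by rw [div_le_one (by linarith)]; exact hk1)
  have h2 : κ * min s (s ^ (1 / k : ℝ)) ≤ min (κ * s) ((κ * s) ^ (1 / k : ℝ)) := by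
    refine le_min (mul_le_mul_of_nonneg_left (min_le_left _ _) hκ) ?_
    rw [Real.mul_rpow hκ hs]
    exact mul_le_mul h1 (min_le_right _ _) (le_min hs (Real.rpow_nonneg hs _)) (hκ.trans h1)
  unfold gain
  calc κ ^ 2 * (s * min s (s ^ (1 / k : ℝ))) = κ * s * (κ * min s (s ^ (1 / k : ℝ))) := by ring
    _ ≤ _ := mul_le_mul_of_nonneg_left h2 (by positivity)

/-- Two tangents, at `ρbar` and halfway to `ρbar + s`, bound the pressure excess from below. -/
lemma exists_gain_le_pressureExcess (hA : 0 < A) (hγ : 1 < γ) (hρbar : 0 < ρbar) {k : ℕ}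
    (hk : 1 ≤ k) (hkγ : 1 / (k : ℝ) ≤ γ - 1) :
    ∃ c > 0, ∀ s, 0 ≤ s → c * gain k s ≤ pressureExcess A γ ρbar (ρbar + s) := by
  set κ := min 1 (1 / (2 * ρbar)) with hκ
  have hκ0 : 0 < κ := lt_min one_pos (by positivity)
  have hκ1 : κ ≤ 1 := min_le_left _ _
  have hP : 0 < A * γ * ρbar ^ (γ - 1) := by positivity
  refine ⟨A * γ * ρbar ^ (γ - 1) * (2 ^ k)⁻¹ * ρbar * κ ^ 2, by positivity, fun s hs => ?_⟩
  have hw : 0 ≤ s / (2 * ρbar) := by positivity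
  have t1 := tangent_le_pressureExcess (ρbar := ρbar) hA hγ (a := ρbar + s / 2) (ρ := ρbar + s)
    (by linarith) (by linarith)
  have t2 := tangent_le_pressureExcess (ρbar := ρbar) hA hγ (a := ρbar) (ρ := ρbar + s / 2)
    hρbar (by linarith)
  simp only [pressureExcess_self, sub_self, zero_mul, add_zero] at t2
  have e1 : (ρbar + s / 2) ^ (γ - 1) = ρbar ^ (γ - 1) * (1 + s / (2 * ρbar)) ^ (γ - 1) := by
    rw [← Real.mul_rpow hρbar.le (by linarith)]
    congr 1
    field_simp
  have e2 : (1 + s / (2 * ρbar)) ^ (1 / k : ℝ) ≤ (1 + s / (2 * ρbar)) ^ (γ - 1) :=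
    Real.rpow_le_rpow_of_exponent_le (by linarith) hkγ
  have e3 := one_add_min_le_rpow hk hw
  have e4 : κ ^ 2 * gain k s ≤ gain k (s / (2 * ρbar)) := by
    refine (sq_mul_gain_le hk hκ0.le hκ1 hs).trans (gain_mono k (by positivity) ?_)
    calc κ * s ≤ 1 / (2 * ρbar) * s := mul_le_mul_of_nonneg_right (min_le_right _ _) hs
      _ = s / (2 * ρbar) := by ring
  rw [e1] at t1
  have e5 : (2 ^ k)⁻¹ * min (s / (2 * ρbar)) ((s / (2 * ρbar)) ^ (1 / k : ℝ))
      ≤ (1 + s / (2 * ρbar)) ^ (γ - 1) - 1 := by linarith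
  have e6 : A * γ * ρbar ^ (γ - 1) * ((2 ^ k)⁻¹ * gain k (s / (2 * ρbar))) * ρbar
      ≤ A * γ * ρbar ^ (γ - 1) * ((1 + s / (2 * ρbar)) ^ (γ - 1) - 1) * (s / 2) := by
    have h := mul_le_mul_of_nonneg_left e5 (show 0 ≤ A * γ * ρbar ^ (γ - 1) * (s / 2) by positivity)
    refine le_trans (le_of_eq ?_) (h.trans (le_of_eq (by ring)))
    unfold gain
    generalize min (s / (2 * ρbar)) ((s / (2 * ρbar)) ^ (1 / k : ℝ)) = m
    field_simp
  have e7 : A * γ * ρbar ^ (γ - 1) * ((2 ^ k)⁻¹ * (κ ^ 2 * gain k s)) * ρbar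
      ≤ A * γ * ρbar ^ (γ - 1) * ((2 ^ k)⁻¹ * gain k (s / (2 * ρbar))) * ρbar := by gcongr
  nlinarith [e6, e7, t1, t2]

lemma quadratic_le_of_hasDerivAt {F F' : ℝ → ℝ} {a h δ : ℝ}
    (hF : ∀ x, HasDerivAt F (F' x) x) (hFa : F a = 0)
    (hF' : ∀ x, |x - a| < δ → h * (x - a) ^ 2 ≤ F' x * (x - a)) {x : ℝ} (hx : |x - a| < δ) :
    h / 2 * (x - a) ^ 2 ≤ F x := by
  set G : ℝ → ℝ := fun y => F (a + y * (x - a)) - h / 2 * (x - a) ^ 2 * y ^ 2 with hG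
  have hGd : ∀ y, HasDerivAt G (F' (a + y * (x - a)) * (x - a) - h * (x - a) ^ 2 * y) y := by
    intro y
    have h1 : HasDerivAt (fun y : ℝ => a + y * (x - a)) (x - a) y := by
      simpa using ((hasDerivAt_id y).mul_const (x - a)).const_add a
    have h2 := ((hF (a + y * (x - a))).comp y h1).sub
      ((hasDerivAt_pow 2 y).const_mul (h / 2 * (x - a) ^ 2))
    refine h2.congr_deriv ?_
    simp
    ring
  have hmono : MonotoneOn G (Icc 0 1) := by
    refine monotoneOn_of_deriv_nonneg (convex_Icc 0 1)
      (fun y _ => (hGd y).continuousAt.continuousWithinAt)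
      (fun y _ => (hGd y).differentiableAt.differentiableWithinAt) (fun y hy => ?_)
    rw [interior_Icc] at hy
    rw [(hGd y).deriv]
    have h3 : |a + y * (x - a) - a| < δ := by
      rw [add_sub_cancel_left, abs_mul, abs_of_pos hy.1]
      exact lt_of_le_of_lt (mul_le_of_le_one_left (abs_nonneg _) hy.2.le) hx
    have h4 := hF' _ h3
    rw [add_sub_cancel_left] at h4
    have h5 : 0 ≤ y * (F' (a + y * (x - a)) * (x - a) - h * (x - a) ^ 2 * y) := by
      nlinarith [h4]
    exact nonneg_of_mul_nonneg_right h5 hy.1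
  have h6 := hmono (left_mem_Icc.2 zero_le_one) (right_mem_Icc.2 zero_le_one) zero_le_one
  simp only [hG, zero_mul, add_zero, hFa, one_mul, one_pow, mul_one] at h6
  have h7 : a + (x - a) = x := by ring
  rw [h7] at h6
  simpa using h6

/-- A weighted Young inequality. -/
lemma mul_le_of_sq_le {P κ ρ H v : ℝ} (hκ : 0 ≤ κ) (hρ : 0 ≤ ρ) (hH : 0 ≤ H)
    (hsq : P ^ 2 ≤ κ ^ 2 * (2 * ρ * H)) : v * P ≤ κ * (ρ * v ^ 2 / 2 + H) := by
  refine (abs_le_of_sq_le_sq' (a := v * P) ?_ (by positivity)).2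
  calc (v * P) ^ 2 = v ^ 2 * P ^ 2 := by ring
    _ ≤ v ^ 2 * (κ ^ 2 * (2 * ρ * H)) := mul_le_mul_of_nonneg_left hsq (sq_nonneg _)
    _ ≤ (κ * (ρ * v ^ 2 / 2 + H)) ^ 2 := by
      nlinarith [mul_nonneg (sq_nonneg κ) (sq_nonneg (ρ * v ^ 2 / 2 - H))]

/-- Near the state of rest the entropy flux is dominated by any speed `σ` larger than the sound
speed times the entropy. This is what bounds the propagation speed. -/
lemma exists_entropy_flux_bound (hA : 0 < A) (hγ : 1 < γ) (hρbar : 0 < ρbar) {σ : ℝ} (hσ0 : 0 < σ)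
    (hσ : A * γ * ρbar ^ (γ - 1) < σ ^ 2) :
    ∃ δ > 0, ∃ h > 0, ∀ ρ v, |ρ - ρbar| < δ → 0 ≤ v → v < δ →
      0 < ρ ∧ h * (ρ - ρbar) ^ 2 ≤ relEntropy A γ ρbar ρ ∧
      v * (ρ * v ^ 2 / 2 + relEntropy A γ ρbar ρ + |A * ρ ^ γ - A * ρbar ^ γ|)
        ≤ σ * (ρ * v ^ 2 / 2 + relEntropy A γ ρbar ρ) := by
  set c2 := A * γ * ρbar ^ (γ - 1) with hc2
  have hc2p : 0 < c2 := by positivity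
  -- a speed `κ` strictly between the sound speed and `σ`, and a tolerance `τ > 1`
  set κ := (Real.sqrt c2 + σ) / 2 with hκ
  have hs : Real.sqrt c2 < σ := (Real.sqrt_lt' hσ0).2 hσ
  have hκσ : κ < σ := by rw [hκ]; linarith
  have hκ0 : 0 < κ := by have := Real.sqrt_nonneg c2; rw [hκ]; linarith
  have hκ2 : c2 < κ ^ 2 := (Real.sqrt_lt' hκ0).1 (by rw [hκ]; linarith)
  obtain ⟨τ, hτ1, hτ⟩ : ∃ τ : ℝ, 1 < τ ∧ c2 * τ ^ 4 < κ ^ 2 := by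
    have hc : Tendsto (fun τ : ℝ => c2 * τ ^ 4) (𝓝 1) (𝓝 (c2 * 1 ^ 4)) :=
      Continuous.tendsto (by fun_prop) 1
    have h1 := hc.eventually (eventually_lt_nhds (show c2 * 1 ^ 4 < κ ^ 2 by simpa using hκ2))
    have h2 := (h1.filter_mono nhdsWithin_le_nhds).and
      (self_mem_nhdsWithin (a := (1 : ℝ)) (s := Ioi 1))
    obtain ⟨τ, h3, h4⟩ := h2.exists
    exact ⟨τ, h4, h3⟩
  have hτ0 : 0 < τ := by linarith
  -- linearization of the pressure and of the derivative of the entropy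
  have dp : HasDerivAt (fun ρ => A * ρ ^ γ) c2 ρbar := hasDerivAt_pressure hγ ρbar
  have dH : HasDerivAt (fun ρ => (A * γ * ρ ^ (γ - 1) - A * γ * ρbar ^ (γ - 1)) / (γ - 1))
      (c2 / ρbar) ρbar := by
    have h1 := (((Real.hasDerivAt_rpow_const (x := ρbar) (p := γ - 1)
      (Or.inl hρbar.ne')).const_mul (A * γ)).sub_const (A * γ * ρbar ^ (γ - 1))).div_const (γ - 1)
    refine h1.congr_deriv ?_
    have h3 : γ - 1 ≠ 0 := by linarith
    rw [hc2, Real.rpow_sub_one hρbar.ne' (γ - 1)]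
    field_simp
  have ep := (hasDerivAt_iff_isLittleO.1 dp).def (c := c2 * (τ - 1)) (by nlinarith)
  have hτi : τ⁻¹ < 1 := inv_lt_one_of_one_lt₀ hτ1
  have eH := (hasDerivAt_iff_isLittleO.1 dH).def (c := c2 / ρbar * (1 - τ⁻¹))
    (mul_pos (by positivity) (by linarith))
  have er : ∀ᶠ ρ in 𝓝 ρbar, ρbar / τ < ρ := eventually_gt_nhds (by
    rw [div_lt_iff₀ hτ0]; nlinarith)
  obtain ⟨δ₁, hδ₁, hball⟩ := Metric.eventually_nhds_iff.1 ((ep.and eH).and er)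
  refine ⟨min δ₁ (σ - κ), lt_min hδ₁ (by linarith), c2 / ρbar / τ / 2, by positivity, ?_⟩
  intro ρ v hρ hv hvδ
  have hρ1 : |ρ - ρbar| < δ₁ := hρ.trans_le (min_le_left _ _)
  have hv2 : v < σ - κ := hvδ.trans_le (min_le_right _ _)
  obtain ⟨⟨h1, -⟩, h3⟩ := hball (y := ρ) (by rwa [Real.dist_eq])
  have hρ0 : 0 < ρ := lt_trans (by positivity) h3
  have hH : c2 / ρbar / τ / 2 * (ρ - ρbar) ^ 2 ≤ relEntropy A γ ρbar ρ := by
    refine quadratic_le_of_hasDerivAt (δ := δ₁) (fun x => hasDerivAt_relEntropy hγ x)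
      relEntropy_self (fun x hx => ?_) hρ1
    obtain ⟨⟨-, h2⟩, -⟩ := hball (y := x) (by rwa [Real.dist_eq])
    simp only [sub_self, zero_div, sub_zero, smul_eq_mul, Real.norm_eq_abs] at h2
    set D := (A * γ * x ^ (γ - 1) - A * γ * ρbar ^ (γ - 1)) / (γ - 1) with hD
    have h5 : |D - (x - ρbar) * (c2 / ρbar)| * |x - ρbar|
        ≤ c2 / ρbar * (1 - τ⁻¹) * (x - ρbar) ^ 2 := by
      calc _ ≤ c2 / ρbar * (1 - τ⁻¹) * |x - ρbar| * |x - ρbar| :=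
            mul_le_mul_of_nonneg_right h2 (abs_nonneg _)
        _ = _ := by rw [mul_assoc, abs_mul_abs_self]; ring
    rw [← abs_mul] at h5
    have h6 := (abs_le.1 h5).1
    rw [div_eq_mul_inv (c2 / ρbar) τ]
    nlinarith [h6]
  have hp : |A * ρ ^ γ - A * ρbar ^ γ| ≤ c2 * τ * |ρ - ρbar| := by
    simp only [smul_eq_mul, Real.norm_eq_abs] at h1
    have h5 : |A * ρ ^ γ - A * ρbar ^ γ|
        ≤ |A * ρ ^ γ - A * ρbar ^ γ - (ρ - ρbar) * c2| + |(ρ - ρbar) * c2| := by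
      have := abs_add_le (A * ρ ^ γ - A * ρbar ^ γ - (ρ - ρbar) * c2) ((ρ - ρbar) * c2)
      rwa [sub_add_cancel] at this
    rw [abs_mul (ρ - ρbar) c2, abs_of_pos hc2p] at h5
    nlinarith [abs_nonneg (ρ - ρbar)]
  refine ⟨hρ0, hH, ?_⟩
  set H := relEntropy A γ ρbar ρ with hHdef
  have hH0 : 0 ≤ H := le_trans (by positivity) hH
  -- `|p - p(ρbar)|² ≤ κ² · 2 ρ H`, whence Young's inequality
  have hsq : |A * ρ ^ γ - A * ρbar ^ γ| ^ 2 ≤ κ ^ 2 * (2 * ρ * H) := by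
    have a1 : |A * ρ ^ γ - A * ρbar ^ γ| ^ 2 ≤ (c2 * τ * |ρ - ρbar|) ^ 2 :=
      pow_le_pow_left₀ (abs_nonneg _) hp 2
    rw [mul_pow, sq_abs (ρ - ρbar)] at a1
    have a2 : (c2 * τ) ^ 2 * (ρ - ρbar) ^ 2 ≤ κ ^ 2 * (2 * (ρbar / τ)
        * (c2 / ρbar / τ / 2 * (ρ - ρbar) ^ 2)) := by
      have a3 : (c2 * τ) ^ 2 ≤ κ ^ 2 * (2 * (ρbar / τ) * (c2 / ρbar / τ / 2)) := by
        have : κ ^ 2 * (2 * (ρbar / τ) * (c2 / ρbar / τ / 2)) = κ ^ 2 * c2 / τ ^ 2 := by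
          field_simp
        rw [this, le_div_iff₀ (by positivity)]
        nlinarith [mul_le_mul_of_nonneg_left hτ.le hc2p.le]
      calc _ ≤ κ ^ 2 * (2 * (ρbar / τ) * (c2 / ρbar / τ / 2)) * (ρ - ρbar) ^ 2 :=
            mul_le_mul_of_nonneg_right a3 (sq_nonneg _)
        _ = _ := by ring
    refine (a1.trans a2).trans ?_
    have a4 : 2 * (ρbar / τ) * (c2 / ρbar / τ / 2 * (ρ - ρbar) ^ 2) ≤ 2 * ρ * H :=
      mul_le_mul (by linarith) hH (by positivity) (by positivity)
    exact mul_le_mul_of_nonneg_left a4 (by positivity)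
  have hY := mul_le_of_sq_le (v := v) hκ0.le hρ0.le hH0 hsq
  have hE : 0 ≤ ρ * v ^ 2 / 2 + H := by positivity
  have hfin := mul_le_mul_of_nonneg_right hv2.le hE
  linarith

end DampedEuler

/-! ### Finite speed of propagation -/

namespace DampedEuler

open Filter Topology

variable {n : ℕ}

/-- The algebra behind the entropy balance: `u · (momentum) + (H' - |u|² / 2) (mass)`. Here `dρ j`
stands for `∂ⱼρ` and `du i j` for `∂ⱼuᵢ`. -/
lemma entropy_balance_algebra {ρ ρt a H H' P p' : ℝ} {u ut dρ : Fin n → ℝ}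
    {du : Fin n → Fin n → ℝ} (hgibbs : ρ * H' = H + P)
    (hmass : ρt + ∑ j, (dρ j * u j + ρ * du j j) = 0)
    (hmom : ∀ i, ρt * u i + ρ * ut i
      + ∑ j, ((dρ j * u i + ρ * du i j) * u j + ρ * u i * du j j)
      + p' * dρ i + a * (ρ * u i) = 0) :
    (ρt * (∑ i, u i ^ 2) / 2 + ρ * ∑ i, u i * ut i + H' * ρt)
      + ∑ j, (du j j * (ρ * (∑ i, u i ^ 2) / 2 + H + P)
        + u j * (dρ j * (∑ i, u i ^ 2) / 2 + ρ * ∑ i, u i * du i j + (H' + p') * dρ j))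
      = -(a * (ρ * ∑ i, u i ^ 2)) := by
  have hm : ρt + ∑ j, dρ j * u j + ρ * ∑ j, du j j = 0 := by
    rw [← hmass, Finset.sum_add_distrib, Finset.mul_sum]; ring
  have hi : ∀ i, ρ * (u i * ut i) + ρ * ∑ j, u j * (u i * du i j) + p' * (u i * dρ i)
      + a * ρ * u i ^ 2 = 0 := by
    intro i
    have h1 : ∑ j, ((dρ j * u i + ρ * du i j) * u j + ρ * u i * du j j)
        = u i * ∑ j, (dρ j * u j + ρ * du j j) + ρ * ∑ j, u j * du i j := by
      rw [Finset.mul_sum, Finset.mul_sum, ← Finset.sum_add_distrib]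
      exact Finset.sum_congr rfl fun j _ => by ring
    have h2 : ∑ j, u j * (u i * du i j) = u i * ∑ j, u j * du i j := by
      rw [Finset.mul_sum]; exact Finset.sum_congr rfl fun j _ => by ring
    have h3 := hmom i
    rw [h1] at h3
    rw [h2]
    linear_combination u i * h3 - u i ^ 2 * hmass
  have hs : ρ * ∑ i, u i * ut i + ρ * ∑ i, ∑ j, u j * (u i * du i j) + p' * ∑ i, u i * dρ i
      + a * ρ * ∑ i, u i ^ 2 = 0 := by
    have h := Finset.sum_eq_zero fun i (_ : i ∈ Finset.univ) => hi i
    simpa only [Finset.sum_add_distrib, ← Finset.mul_sum] using h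
  rw [Finset.sum_comm] at hs
  have hd : ∀ S : ℝ, ∑ j, (du j j * (ρ * S / 2 + H + P)
        + u j * (dρ j * S / 2 + ρ * ∑ i, u i * du i j + (H' + p') * dρ j))
      = (ρ * S / 2 + H + P) * ∑ j, du j j + (S / 2 + H' + p') * ∑ j, dρ j * u j
        + ρ * ∑ j, ∑ i, u j * (u i * du i j) := by
    intro S
    rw [Finset.mul_sum, Finset.mul_sum, Finset.mul_sum, ← Finset.sum_add_distrib,
      ← Finset.sum_add_distrib]
    refine Finset.sum_congr rfl fun j _ => ?_
    rw [← Finset.mul_sum]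
    ring
  have hc : ∑ i, u i * dρ i = ∑ j, dρ j * u j := Finset.sum_congr rfl fun _ _ => by ring
  rw [hc] at hs
  rw [hd]
  linear_combination hs + ((∑ i, u i ^ 2) / 2 + H') * hm - (∑ j, du j j) * hgibbs

/-- The entropy density relative to the state of rest. -/
noncomputable def entropy (A γ ρbar : ℝ) (ρ : ℝ) (v : Space n) : ℝ :=
  ρ * (∑ i, v i ^ 2) / 2 + relEntropy A γ ρbar ρ

/-- The entropy plus the relative pressure; the entropy flux is this multiple of the velocity. -/
noncomputable def entropyFlux (A γ ρbar : ℝ) (ρ : ℝ) (v : Space n) : ℝ :=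
  entropy A γ ρbar ρ v + (A * ρ ^ γ - A * ρbar ^ γ)

lemma contDiffOn_entropy {A γ ρbar : ℝ} (hγ : 1 < γ) {E : Type*} [NormedAddCommGroup E]
    [NormedSpace ℝ E] {S : Set E} {r : E → ℝ} {v : E → Space n} (hr : ContDiffOn ℝ 1 r S)
    (hv : ContDiffOn ℝ 1 v S) : ContDiffOn ℝ 1 (fun z => entropy A γ ρbar (r z) (v z)) S := by
  have hvi : ∀ i, ContDiffOn ℝ 1 (fun z => v z i) S := contDiffOn_euclidean.1 hv
  unfold entropy
  exact ((hr.mul (ContDiffOn.sum fun i _ => (hvi i).pow 2)).div_const 2).add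
    ((contDiff_relEntropy hγ).comp_contDiffOn hr)

lemma contDiffOn_entropyFlux {A γ ρbar : ℝ} (hγ : 1 < γ) {E : Type*} [NormedAddCommGroup E]
    [NormedSpace ℝ E] {S : Set E} {r : E → ℝ} {v : E → Space n} (hr : ContDiffOn ℝ 1 r S)
    (hv : ContDiffOn ℝ 1 v S) : ContDiffOn ℝ 1 (fun z => entropyFlux A γ ρbar (r z) (v z)) S := by
  unfold entropyFlux
  exact (contDiffOn_entropy hγ hr hv).add
    (((contDiff_pressure hγ).comp_contDiffOn hr).sub contDiffOn_const)

variable {A γ mu lam ρbar : ℝ} {ρ₀ : Space n → ℝ} {u₀ : Space n → Space n} {ε : ℝ} {T : ℝ≥0∞}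
  {ρ : ℝ → Space n → ℝ} {u : ℝ → Space n → Space n}

namespace IsC1Solution

lemma contDiff_density (sol : IsC1Solution A γ mu lam ρbar ρ₀ u₀ ε T ρ u) {t : ℝ}
    (ht : t ∈ timeInterval T) : ContDiff ℝ 1 (ρ t) := contDiff_slice sol.density_C1 ht

lemma contDiff_velocity (sol : IsC1Solution A γ mu lam ρbar ρ₀ u₀ ε T ρ u) {t : ℝ}
    (ht : t ∈ timeInterval T) (i : Fin n) : ContDiff ℝ 1 (fun x => u t x i) :=
  contDiff_euclidean.1 (contDiff_slice sol.velocity_C1 ht) i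

/-- The local entropy balance: the relative entropy is dissipated by the damping only. -/
lemma entropy_balance (sol : IsC1Solution A γ mu lam ρbar ρ₀ u₀ ε T ρ u) (hγ : 1 < γ)
    (hρbar : 0 < ρbar) {t : ℝ} (ht : t ∈ timeInterval T) (h0 : 0 < t) (x : Space n) :
    deriv (fun s => entropy A γ ρbar (ρ s x) (u s x)) t
      + ∑ j, partialDeriv j (fun y => u t y j * entropyFlux A γ ρbar (ρ t y) (u t y)) x
      = -(mu / (1 + t) ^ lam * (ρ t x * ∑ i, u t x i ^ 2)) := by
  have dρ : DifferentiableAt ℝ (ρ t) x := (sol.contDiff_density ht).differentiable one_ne_zero x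
  have du : ∀ i, DifferentiableAt ℝ (fun y => u t y i) x := fun i =>
    (sol.contDiff_velocity ht i).differentiable one_ne_zero x
  have dρt : HasDerivAt (fun s => ρ s x) (deriv (fun s => ρ s x) t) t :=
    (differentiableAt_time sol.density_C1 ht h0 x).hasDerivAt
  have dut : ∀ i, HasDerivAt (fun s => u s x i) (deriv (fun s => u s x i) t) t := fun i =>
    (differentiableAt_euclidean.1 (differentiableAt_time sol.velocity_C1 ht h0 x) i).hasDerivAt
  set H' := (A * γ * ρ t x ^ (γ - 1) - A * γ * ρbar ^ (γ - 1)) / (γ - 1) with hH'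
  set p' := A * γ * ρ t x ^ (γ - 1) with hp'
  have hH : HasDerivAt (relEntropy A γ ρbar) H' (ρ t x) := hasDerivAt_relEntropy hγ _
  have hp : HasDerivAt (fun ρ => A * ρ ^ γ) p' (ρ t x) := hasDerivAt_pressure hγ _
  have dsq : DifferentiableAt ℝ (fun y => ∑ i, u t y i ^ 2) x :=
    DifferentiableAt.fun_sum fun i _ => (du i).pow 2
  have psq : ∀ j, partialDeriv j (fun y => ∑ i, u t y i ^ 2) x
      = 2 * ∑ i, u t x i * partialDeriv j (fun y => u t y i) x := by
    intro j
    have h1 : HasFDerivAt (fun y => ∑ i, u t y i ^ 2)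
        (∑ i, (2 * u t x i) • fderiv ℝ (fun y => u t y i) x) x := by
      refine HasFDerivAt.fun_sum fun i _ => ?_
      simpa using (du i).hasFDerivAt.pow 2
    simp only [partialDeriv, h1.fderiv, sum_apply,
      smul_apply, smul_eq_mul, Finset.mul_sum]
    exact Finset.sum_congr rfl fun i _ => by ring
  have hη : deriv (fun s => entropy A γ ρbar (ρ s x) (u s x)) t
      = deriv (fun s => ρ s x) t * (∑ i, u t x i ^ 2) / 2
        + ρ t x * ∑ i, u t x i * deriv (fun s => u s x i) t
        + H' * deriv (fun s => ρ s x) t := by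
    have h1 : HasDerivAt (fun s => ∑ i, u s x i ^ 2)
        (∑ i, 2 * u t x i * deriv (fun s => u s x i) t) t := by
      refine HasDerivAt.fun_sum fun i _ => ?_
      simpa using (dut i).fun_pow 2
    have h2 := ((dρt.mul h1).div_const 2).add (hH.comp t dρt)
    have h3 : (∑ i, 2 * u t x i * deriv (fun s => u s x i) t)
        = 2 * ∑ i, u t x i * deriv (fun s => u s x i) t := by
      rw [Finset.mul_sum]; exact Finset.sum_congr rfl fun i _ => by ring
    rw [h3] at h2
    refine (HasDerivAt.deriv (f := fun s => entropy A γ ρbar (ρ s x) (u s x)) h2).trans ?_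
    ring
  have dH : DifferentiableAt ℝ (fun y => relEntropy A γ ρbar (ρ t y)) x :=
    hH.differentiableAt.comp x dρ
  have dp : DifferentiableAt ℝ (fun y => A * ρ t y ^ γ) x :=
    DifferentiableAt.comp (g := fun r : ℝ => A * r ^ γ) x hp.differentiableAt dρ
  have dP : DifferentiableAt ℝ (fun y => A * ρ t y ^ γ + -(A * ρbar ^ γ)) x := dp.add_const _
  have dK : DifferentiableAt ℝ (fun y => (1 / 2 : ℝ) * (ρ t y * ∑ i, u t y i ^ 2)) x :=
    (dρ.mul dsq).const_mul _
  have pconst : ∀ (j : Fin n) (c : ℝ), partialDeriv j (fun _ : Space n => c) x = 0 := by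
    intro j c; simp [partialDeriv]
  have hflux : ∀ j, partialDeriv j (fun y => u t y j * entropyFlux A γ ρbar (ρ t y) (u t y)) x
      = partialDeriv j (fun y => u t y j) x * (ρ t x * (∑ i, u t x i ^ 2) / 2
          + relEntropy A γ ρbar (ρ t x) + (A * ρ t x ^ γ - A * ρbar ^ γ))
        + u t x j * (partialDeriv j (ρ t) x * (∑ i, u t x i ^ 2) / 2
          + ρ t x * ∑ i, u t x i * partialDeriv j (fun y => u t y i) x
          + (H' + p') * partialDeriv j (ρ t) x) := by
    intro j
    have e : (fun y => u t y j * entropyFlux A γ ρbar (ρ t y) (u t y)) = fun y => u t y j *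
        (((1 / 2 : ℝ) * (ρ t y * ∑ i, u t y i ^ 2) + relEntropy A γ ρbar (ρ t y))
          + (A * ρ t y ^ γ + -(A * ρbar ^ γ))) := by
      funext y; simp only [entropyFlux, entropy]; ring
    rw [e, partialDeriv_mul (du j) ((dK.fun_add dH).fun_add dP),
      partialDeriv_add (dK.fun_add dH) dP,
      partialDeriv_add dK dH, partialDeriv_add dp (differentiableAt_const _),
      partialDeriv_mul (differentiableAt_const _) (dρ.fun_mul dsq), partialDeriv_mul dρ dsq,
      partialDeriv_comp hH dρ, partialDeriv_comp (F := fun r => A * r ^ γ) hp dρ, psq j,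
      pconst, pconst]
    ring
  rw [hη, Finset.sum_congr rfl fun j _ => hflux j]
  refine entropy_balance_algebra (u := fun i => u t x i) (ut := fun i => deriv (fun s => u s x i) t)
    (dρ := fun j => partialDeriv j (ρ t) x) (du := fun i j => partialDeriv j (fun y => u t y i) x)
    (p' := p') (mul_deriv_relEntropy hγ hρbar (sol.density_nonneg t ht x)) ?_ ?_
  · have h1 := sol.mass t ht h0 x
    rwa [Finset.sum_congr rfl fun j _ => partialDeriv_mul dρ (du j)] at h1
  · intro i
    have h1 := sol.momentum t ht h0 x i
    have h2 : deriv (fun s => ρ s x * u s x i) t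
        = deriv (fun s => ρ s x) t * u t x i + ρ t x * deriv (fun s => u s x i) t :=
      (dρt.mul (dut i)).deriv
    rw [h2, partialDeriv_comp (F := fun r => A * r ^ γ) hp dρ,
      Finset.sum_congr rfl fun j _ => partialDeriv_mul (dρ.fun_mul (du i)) (du j)] at h1
    simp only [partialDeriv_mul dρ (du i)] at h1
    exact h1

end IsC1Solution

/-- A `C¹` weight that, at times `t ≤ τ`, is positive exactly in the open backward cone of slope
`σ` and apex `(τ, x₀)`. -/
noncomputable def coneWeight (σ τ : ℝ) (x₀ : Space n) (t : ℝ) (x : Space n) : ℝ :=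
  max (σ ^ 2 * (τ - t) ^ 2 - ‖x - x₀‖ ^ 2) 0 ^ 2

lemma hasDerivAt_max_zero_sq (y : ℝ) :
    HasDerivAt (fun y : ℝ => max y 0 ^ 2) (2 * max y 0) y := by
  rcases lt_trichotomy y 0 with h | rfl | h
  · rw [max_eq_right h.le, mul_zero]
    refine (hasDerivAt_const y (0 : ℝ)).congr_of_eventuallyEq ?_
    filter_upwards [eventually_lt_nhds h] with z hz
    simp [max_eq_right hz.le]
  · rw [hasDerivAt_iff_isLittleO]
    simp only [max_self, mul_zero, smul_zero, sub_zero, ne_eq, OfNat.ofNat_ne_zero,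
      not_false_eq_true, zero_pow]
    refine Asymptotics.IsBigO.trans_isLittleO (g := fun y : ℝ => y ^ 2) ?_ ?_
    · refine Asymptotics.IsBigO.of_bound 1 (Eventually.of_forall fun z => ?_)
      rw [one_mul, norm_pow, norm_pow, Real.norm_eq_abs, Real.norm_eq_abs]
      refine pow_le_pow_left₀ (abs_nonneg _) ?_ 2
      rcases le_total z 0 with h | h
      · simp [max_eq_right h]
      · simp [max_eq_left h]
    · simpa using Asymptotics.isLittleO_pow_id (𝕜 := ℝ) (n := 2) one_lt_two
  · rw [max_eq_left h.le]
    have h1 : HasDerivAt (fun y : ℝ => y ^ 2) (2 * y) y := by simpa using hasDerivAt_pow 2 y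
    refine h1.congr_of_eventuallyEq ?_
    filter_upwards [eventually_gt_nhds h] with z hz
    rw [max_eq_left hz.le]

lemma contDiff_max_zero_sq : ContDiff ℝ 1 (fun y : ℝ => max y 0 ^ 2) := by
  refine contDiff_one_iff_deriv.2 ⟨fun y => (hasDerivAt_max_zero_sq y).differentiableAt, ?_⟩
  rw [show deriv (fun y : ℝ => max y 0 ^ 2) = fun y => 2 * max y 0 from
    funext fun y => (hasDerivAt_max_zero_sq y).deriv]
  fun_prop

lemma contDiff_coneWeight (σ τ : ℝ) (x₀ : Space n) :
    ContDiff ℝ 1 (fun z : ℝ × Space n => coneWeight σ τ x₀ z.1 z.2) := by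
  have h : ContDiff ℝ 1 (fun z : ℝ × Space n => σ ^ 2 * (τ - z.1) ^ 2 - ‖z.2 - x₀‖ ^ 2) :=
    (contDiff_const.mul ((contDiff_const.sub contDiff_fst).pow 2)).sub
      ((contDiff_snd.sub contDiff_const).norm_sq ℝ)
  exact contDiff_max_zero_sq.comp h

lemma coneWeight_nonneg (σ τ : ℝ) (x₀ : Space n) (t : ℝ) (x : Space n) :
    0 ≤ coneWeight σ τ x₀ t x := by unfold coneWeight; positivity

lemma cone_arg_pos_iff {σ τ t : ℝ} {x₀ x : Space n} (hσ : 0 < σ) (ht : t ≤ τ) :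
    0 < σ ^ 2 * (τ - t) ^ 2 - ‖x - x₀‖ ^ 2 ↔ ‖x - x₀‖ < σ * (τ - t) := by
  rw [sub_pos, ← mul_pow]
  exact pow_lt_pow_iff_left₀ (norm_nonneg _) (mul_nonneg hσ.le (by linarith)) two_ne_zero

lemma coneWeight_eq_zero {σ τ t : ℝ} {x₀ x : Space n} (hσ : 0 < σ) (ht : t ≤ τ)
    (hx : ¬ ‖x - x₀‖ < σ * (τ - t)) : coneWeight σ τ x₀ t x = 0 := by
  rw [← cone_arg_pos_iff hσ ht, not_lt] at hx
  rw [coneWeight, max_eq_right hx]; simp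

lemma coneWeight_pos {σ τ t : ℝ} {x₀ x : Space n} (hσ : 0 < σ) (ht : t ≤ τ)
    (hx : ‖x - x₀‖ < σ * (τ - t)) : 0 < coneWeight σ τ x₀ t x := by
  rw [← cone_arg_pos_iff hσ ht] at hx
  rw [coneWeight, max_eq_left hx.le]; positivity

lemma hasDerivAt_coneWeight (σ τ t : ℝ) (x₀ x : Space n) :
    HasDerivAt (fun s => coneWeight σ τ x₀ s x)
      (2 * max (σ ^ 2 * (τ - t) ^ 2 - ‖x - x₀‖ ^ 2) 0 * (-2 * σ ^ 2 * (τ - t))) t := by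
  have h1 : HasDerivAt (fun s : ℝ => σ ^ 2 * (τ - s) ^ 2 - ‖x - x₀‖ ^ 2)
      (-2 * σ ^ 2 * (τ - t)) t := by
    have := ((((hasDerivAt_id t).const_sub τ).pow 2).const_mul (σ ^ 2)).sub_const (‖x - x₀‖ ^ 2)
    refine this.congr_deriv ?_
    simp; ring
  exact (hasDerivAt_max_zero_sq _).comp t h1

lemma partialDeriv_coneWeight (σ τ t : ℝ) (x₀ x : Space n) (j : Fin n) :
    partialDeriv j (coneWeight σ τ x₀ t) x
      = 2 * max (σ ^ 2 * (τ - t) ^ 2 - ‖x - x₀‖ ^ 2) 0 * (-2 * (x j - x₀ j)) := by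
  have h1 : HasFDerivAt (fun y : Space n => σ ^ 2 * (τ - t) ^ 2 - ‖y - x₀‖ ^ 2)
      (-(2 • (innerSL ℝ (x - x₀)))) x := by
    have := ((hasFDerivAt_id x).sub_const x₀).norm_sq.const_sub (σ ^ 2 * (τ - t) ^ 2)
    simpa using this
  have h2 := (hasDerivAt_max_zero_sq _).comp_hasFDerivAt x h1
  rw [partialDeriv, show coneWeight σ τ x₀ t = (fun y : ℝ => max y 0 ^ 2) ∘
    (fun y : Space n => σ ^ 2 * (τ - t) ^ 2 - ‖y - x₀‖ ^ 2) from rfl, h2.fderiv]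
  simp [EuclideanSpace.inner_single_right]

namespace IsC1Solution

/-- In the region where the flux is dominated by `σ` times the entropy, the entropy balance weighted
by a cone of slope `σ` has a sign: the decay of the weight in time absorbs the outward flux. -/
lemma weighted_entropy_balance_nonpos (sol : IsC1Solution A γ mu lam ρbar ρ₀ u₀ ε T ρ u)
    (hγ : 1 < γ) (hρbar : 0 < ρbar) (hmu : 0 ≤ mu) {t : ℝ} (ht : t ∈ timeInterval T) (h0 : 0 < t)
    {σ τ : ℝ} (hσ : 0 < σ) (htτ : t ≤ τ) (x₀ x : Space n)
    (hflux : ‖x - x₀‖ < σ * (τ - t) → ‖u t x‖ * |entropyFlux A γ ρbar (ρ t x) (u t x)|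
      ≤ σ * entropy A γ ρbar (ρ t x) (u t x)) :
    deriv (fun s => coneWeight σ τ x₀ s x * entropy A γ ρbar (ρ s x) (u s x)) t
      + ∑ j, partialDeriv j (fun y => coneWeight σ τ x₀ t y *
          (u t y j * entropyFlux A γ ρbar (ρ t y) (u t y))) x ≤ 0 := by
  have hηC : ContDiffOn ℝ 1 (fun z : ℝ × Space n => entropy A γ ρbar (ρ z.1 z.2) (u z.1 z.2))
      (timeInterval T ×ˢ univ) := contDiffOn_entropy hγ sol.density_C1 sol.velocity_C1
  have hη := differentiableAt_time (g := fun s x => entropy A γ ρbar (ρ s x) (u s x)) hηC ht h0 x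
  have hF : ContDiff ℝ 1 (fun y => entropyFlux A γ ρbar (ρ t y) (u t y)) :=
    contDiffOn_univ.1 (contDiffOn_entropyFlux hγ (sol.contDiff_density ht).contDiffOn
      (contDiff_slice sol.velocity_C1 ht).contDiffOn)
  have hq : ∀ j, DifferentiableAt ℝ
      (fun y => u t y j * entropyFlux A γ ρbar (ρ t y) (u t y)) x := fun j =>
    ((sol.contDiff_velocity ht j).mul hF).differentiable one_ne_zero x
  have hψ : DifferentiableAt ℝ (coneWeight σ τ x₀ t) x := by
    have h1 : ContDiff ℝ 1 (fun y : Space n => (t, y)) := by fun_prop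
    exact ((contDiff_coneWeight σ τ x₀).comp h1).differentiable one_ne_zero x
  set η := entropy A γ ρbar (ρ t x) (u t x) with hηdef
  set F := entropyFlux A γ ρbar (ρ t x) (u t x) with hFdef
  set m := max (σ ^ 2 * (τ - t) ^ 2 - ‖x - x₀‖ ^ 2) 0 with hm
  have hd : deriv (fun s => coneWeight σ τ x₀ s x * entropy A γ ρbar (ρ s x) (u s x)) t
      = 2 * m * (-2 * σ ^ 2 * (τ - t)) * η
        + coneWeight σ τ x₀ t x * deriv (fun s => entropy A γ ρbar (ρ s x) (u s x)) t :=
    ((hasDerivAt_coneWeight σ τ t x₀ x).mul hη.hasDerivAt).deriv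
  have hs : ∑ j, partialDeriv j (fun y => coneWeight σ τ x₀ t y *
        (u t y j * entropyFlux A γ ρbar (ρ t y) (u t y))) x
      = -4 * m * F * ∑ j, (x j - x₀ j) * u t x j + coneWeight σ τ x₀ t x *
        ∑ j, partialDeriv j (fun y => u t y j * entropyFlux A γ ρbar (ρ t y) (u t y)) x := by
    rw [Finset.mul_sum, Finset.mul_sum, ← Finset.sum_add_distrib]
    refine Finset.sum_congr rfl fun j _ => ?_
    rw [partialDeriv_mul hψ (hq j), partialDeriv_coneWeight]
    ring
  have hbal := sol.entropy_balance hγ hρbar ht h0 x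
  have hdamp : 0 ≤ coneWeight σ τ x₀ t x * (mu / (1 + t) ^ lam * (ρ t x * ∑ i, u t x i ^ 2)) := by
    refine mul_nonneg (coneWeight_nonneg _ _ _ _ _) (mul_nonneg ?_ (mul_nonneg
      (sol.density_nonneg t ht x) (Finset.sum_nonneg fun i _ => sq_nonneg _)))
    exact div_nonneg hmu (Real.rpow_nonneg (by linarith) _)
  have hmain : 0 ≤ m * (σ ^ 2 * (τ - t) * η + F * ∑ j, (x j - x₀ j) * u t x j) := by
    by_cases hx : ‖x - x₀‖ < σ * (τ - t)
    · refine mul_nonneg (le_max_right _ _) ?_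
      have h1 : |∑ j, (x j - x₀ j) * u t x j| ≤ ‖x - x₀‖ * ‖u t x‖ := by
        have h2 := abs_real_inner_le_norm (u t x) (x - x₀)
        rw [PiLp.inner_apply] at h2
        simpa [mul_comm] using h2
      have h3 : |F * ∑ j, (x j - x₀ j) * u t x j| ≤ σ * (τ - t) * (σ * η) := by
        rw [abs_mul]
        calc |F| * |∑ j, (x j - x₀ j) * u t x j| ≤ |F| * (‖x - x₀‖ * ‖u t x‖) :=
              mul_le_mul_of_nonneg_left h1 (abs_nonneg _)
          _ = ‖x - x₀‖ * (‖u t x‖ * |F|) := by ring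
          _ ≤ σ * (τ - t) * (σ * η) := mul_le_mul hx.le (hflux hx) (by positivity)
              (mul_nonneg hσ.le (by linarith))
      nlinarith [(abs_le.1 h3).1]
    · have h1 : m = 0 := max_eq_right (by
        rwa [← cone_arg_pos_iff hσ htτ, not_lt] at hx)
      rw [h1, zero_mul]
  rw [hd, hs]
  have h5 : coneWeight σ τ x₀ t x * deriv (fun s => entropy A γ ρbar (ρ s x) (u s x)) t
      + coneWeight σ τ x₀ t x *
        ∑ j, partialDeriv j (fun y => u t y j * entropyFlux A γ ρbar (ρ t y) (u t y)) x
      = -(coneWeight σ τ x₀ t x * (mu / (1 + t) ^ lam * (ρ t x * ∑ i, u t x i ^ 2))) := by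
    rw [← mul_add, hbal]; ring
  linarith

/-- As long as the solution is close to rest in a cone of slope `σ`, it stays at rest there. -/
lemma rest_of_close (sol : IsC1Solution A γ mu lam ρbar ρ₀ u₀ ε T ρ u)
    (hγ : 1 < γ) (hρbar : 0 < ρbar) (hmu : 0 ≤ mu) {σ δ h : ℝ} (hσ : 0 < σ) (hh : 0 < h)
    (hflux : ∀ ρ v, |ρ - ρbar| < δ → 0 ≤ v → v < δ →
      0 < ρ ∧ h * (ρ - ρbar) ^ 2 ≤ relEntropy A γ ρbar ρ ∧
      v * (ρ * v ^ 2 / 2 + relEntropy A γ ρbar ρ + |A * ρ ^ γ - A * ρbar ^ γ|)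
        ≤ σ * (ρ * v ^ 2 / 2 + relEntropy A γ ρbar ρ))
    {x₀ : Space n} {τ t₁ t₂ : ℝ} (h1 : 0 ≤ t₁) (h2 : t₂ ∈ timeInterval T)
    (h2τ : t₂ < τ)
    (hclose : ∀ t ∈ Icc t₁ t₂, ∀ x, ‖x - x₀‖ < σ * (τ - t) → |ρ t x - ρbar| < δ ∧ ‖u t x‖ < δ)
    (hrest : ∀ x, ‖x - x₀‖ < σ * (τ - t₁) → ρ t₁ x = ρbar ∧ u t₁ x = 0) :
    ∀ t ∈ Icc t₁ t₂, ∀ x, ‖x - x₀‖ < σ * (τ - t) → ρ t x = ρbar ∧ u t x = 0 := by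
  set g : ℝ → Space n → ℝ := fun s x =>
    coneWeight σ τ x₀ s x * entropy A γ ρbar (ρ s x) (u s x) with hg
  have hmem : ∀ t ∈ Icc t₁ t₂, t ∈ timeInterval T := fun t ht =>
    mem_timeInterval_of_le h2 (h1.trans ht.1) ht.2
  have hgC : ContDiffOn ℝ 1 (fun z : ℝ × Space n => g z.1 z.2) (timeInterval T ×ˢ univ) :=
    (contDiff_coneWeight σ τ x₀).contDiffOn.mul
      (contDiffOn_entropy hγ sol.density_C1 sol.velocity_C1)
  have hK : IsCompact (Metric.closedBall x₀ (σ * τ)) := isCompact_closedBall _ _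
  have hψK : ∀ s, 0 ≤ s → s ≤ τ → ∀ x, x ∉ Metric.closedBall x₀ (σ * τ) →
      coneWeight σ τ x₀ s x = 0 := by
    intro s hs0 hs x hx
    refine coneWeight_eq_zero hσ hs fun hlt => hx ?_
    rw [mem_closedBall_iff_norm]
    nlinarith
  have hv : ∀ t x, entropy A γ ρbar (ρ t x) (u t x)
      = ρ t x * ‖u t x‖ ^ 2 / 2 + relEntropy A γ ρbar (ρ t x) := by
    intro t x; rw [EuclideanSpace.real_norm_sq_eq]; rfl
  have hpt : ∀ t ∈ Icc t₁ t₂, ∀ x, ‖x - x₀‖ < σ * (τ - t) →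
      0 < ρ t x ∧ h * (ρ t x - ρbar) ^ 2 ≤ relEntropy A γ ρbar (ρ t x) ∧
      0 ≤ entropy A γ ρbar (ρ t x) (u t x) ∧
      ‖u t x‖ * |entropyFlux A γ ρbar (ρ t x) (u t x)|
        ≤ σ * entropy A γ ρbar (ρ t x) (u t x) := by
    intro t ht x hx
    obtain ⟨c1, c2⟩ := hclose t ht x hx
    obtain ⟨f1, f2, f3⟩ := hflux (ρ t x) ‖u t x‖ c1 (norm_nonneg _) c2
    have hH : 0 ≤ relEntropy A γ ρbar (ρ t x) := le_trans (by positivity) f2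
    have hη : 0 ≤ entropy A γ ρbar (ρ t x) (u t x) := by rw [hv]; positivity
    refine ⟨f1, f2, hη, ?_⟩
    rw [← hv] at f3
    refine le_trans (mul_le_mul_of_nonneg_left ?_ (norm_nonneg _)) f3
    refine (abs_add_le _ _).trans ?_
    rw [abs_of_nonneg hη]
  have hg0 : ∀ t ∈ Icc t₁ t₂, ∀ x, 0 ≤ g t x := by
    intro t ht x
    by_cases hx : ‖x - x₀‖ < σ * (τ - t)
    · exact mul_nonneg (coneWeight_nonneg _ _ _ _ _) (hpt t ht x hx).2.2.1
    · rw [hg]; simp only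
      rw [coneWeight_eq_zero hσ (ht.2.trans h2τ.le) hx, zero_mul]
  have hgcont : ∀ t ∈ Icc t₁ t₂, Continuous (g t) := fun t ht =>
    (contDiff_slice hgC (hmem t ht)).continuous
  have hgsupp : ∀ t ∈ Icc t₁ t₂, ∀ x, x ∉ Metric.closedBall x₀ (σ * τ) → g t x = 0 := by
    intro t ht x hx
    rw [hg]; simp only
    rw [hψK t (h1.trans ht.1) (ht.2.trans h2τ.le) x hx, zero_mul]
  -- the weighted entropy is nonincreasing and vanishes at time `t₁`
  have hderiv : ∀ t ∈ Ioo t₁ t₂, HasDerivAt (fun s => ∫ x, g s x)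
      (∫ x, deriv (fun s => g s x) t) t := by
    intro t ht
    refine hasDerivAt_integral_of_compact (a := t₁) (b := t₂)
      (hgC.mono (prod_mono (fun s hs => hmem s ⟨hs.1.le, hs.2.le⟩) Subset.rfl)) hK
      (fun s hs => hgsupp s ⟨hs.1.le, hs.2.le⟩) ht
  have hanti : AntitoneOn (fun s => ∫ x, g s x) (Icc t₁ t₂) := by
    refine antitoneOn_of_deriv_nonpos (convex_Icc _ _) ?_ ?_ ?_
    · refine continuousOn_integral_of_compact_support hK ?_ ?_
      · exact hgC.continuousOn.mono (prod_mono hmem Subset.rfl)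
      · exact fun s x hs hx => hgsupp s hs x hx
    · rw [interior_Icc]
      exact fun t ht => (hderiv t ht).differentiableAt.differentiableWithinAt
    · rw [interior_Icc]
      intro t ht
      have htI : t ∈ Icc t₁ t₂ := ⟨ht.1.le, ht.2.le⟩
      have ht0 : 0 < t := h1.trans_lt ht.1
      have htT := hmem t htI
      have htτ : t ≤ τ := ht.2.le.trans h2τ.le
      rw [(hderiv t ht).deriv]
      set q : Fin n → Space n → ℝ := fun j y => coneWeight σ τ x₀ t y *
          (u t y j * entropyFlux A γ ρbar (ρ t y) (u t y)) with hq
      have hqC : ∀ j, ContDiff ℝ 1 (q j) := by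
        intro j
        have e1 : ContDiff ℝ 1 (fun y : Space n => (t, y)) := by fun_prop
        exact ((contDiff_coneWeight σ τ x₀).comp e1).mul ((sol.contDiff_velocity htT j).mul
          (contDiffOn_univ.1 (contDiffOn_entropyFlux hγ (sol.contDiff_density htT).contDiffOn
            (contDiff_slice sol.velocity_C1 htT).contDiffOn)))
      have hqs : ∀ j, HasCompactSupport (q j) := fun j =>
        HasCompactSupport.intro hK fun x hx => by
          rw [hq]; simp only; rw [hψK t ht0.le htτ x hx, zero_mul]
      have hqi : ∀ j, Integrable (partialDeriv j (q j)) := fun j =>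
        (continuous_partialDeriv (hqC j) j).integrable_of_hasCompactSupport
          (hasCompactSupport_partialDeriv (hqs j) j)
      have hz : ∫ x, ∑ j, partialDeriv j (q j) x = 0 := by
        rw [integral_finsetSum _ fun j _ => hqi j]
        exact Finset.sum_eq_zero fun j _ => integral_partialDeriv_eq_zero (hqC j) (hqs j) j
      have hneg : ∫ x, -∑ j, partialDeriv j (q j) x = 0 := by rw [integral_neg, hz, neg_zero]
      rw [← hneg]
      by_cases hint : Integrable (fun x => deriv (fun s => g s x) t)
      · refine integral_mono hint (integrable_finsetSum _ fun j _ => hqi j).neg fun x => ?_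
        have := sol.weighted_entropy_balance_nonpos hγ hρbar hmu htT ht0 hσ htτ x₀ x
          (fun hx => (hpt t htI x hx).2.2.2)
        simp only
        linarith
      · rw [integral_undef hint, hneg]
  have hinit : t₁ ≤ t₂ → ∫ x, g t₁ x = 0 := by
    refine fun hle => integral_eq_zero_of_ae (Eventually.of_forall fun x => ?_)
    by_cases hx : ‖x - x₀‖ < σ * (τ - t₁)
    · obtain ⟨e1, e2⟩ := hrest x hx
      simp [hg, entropy, e1, e2]
    · simp [hg, coneWeight_eq_zero hσ (hle.trans h2τ.le) hx]
  intro t ht x hx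
  have hle := hanti (left_mem_Icc.2 (ht.1.trans ht.2)) ht ht.1
  simp only [hinit (ht.1.trans ht.2)] at hle
  have hgx : g t x = 0 := by
    by_contra hne
    have := (hgcont t ht).integral_pos_of_hasCompactSupport_nonneg_nonzero
      (μ := (volume : Measure (Space n)))
      (HasCompactSupport.intro hK (hgsupp t ht)) (hg0 t ht) hne
    linarith
  obtain ⟨p1, p2, p3, -⟩ := hpt t ht x hx
  have hη0 : entropy A γ ρbar (ρ t x) (u t x) = 0 :=
    (mul_eq_zero.1 hgx).resolve_left (coneWeight_pos hσ (ht.2.trans h2τ.le) hx).ne'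
  rw [hv] at hη0
  have q1 : 0 ≤ ρ t x * ‖u t x‖ ^ 2 / 2 := by positivity
  have q2 : 0 ≤ h * (ρ t x - ρbar) ^ 2 := by positivity
  have q3 : h * (ρ t x - ρbar) ^ 2 = 0 := by linarith
  have q4 : ρ t x * ‖u t x‖ ^ 2 = 0 := by linarith
  constructor
  · have := pow_eq_zero_iff (two_ne_zero) |>.1 ((mul_eq_zero.1 q3).resolve_left hh.ne')
    linarith
  · exact norm_eq_zero.1 (pow_eq_zero_iff two_ne_zero |>.1 ((mul_eq_zero.1 q4).resolve_left p1.ne'))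

/-- Domain of dependence: a solution initially at rest on the base of a cone whose slope exceeds
the sound speed stays at rest in the cone. No bound on the solution at infinity is needed, the cone
being bounded. -/
lemma rest_in_cone (sol : IsC1Solution A γ mu lam ρbar ρ₀ u₀ ε T ρ u) (hA : 0 < A)
    (hγ : 1 < γ) (hρbar : 0 < ρbar) (hmu : 0 ≤ mu) {σ : ℝ} (hσ : 0 < σ)
    (hσc : A * γ * ρbar ^ (γ - 1) < σ ^ 2) {x₀ : Space n} {τ t₀ : ℝ} (ht₀ : t₀ ∈ timeInterval T)
    (hτ : t₀ < τ) (hrest : ∀ x, ‖x - x₀‖ < σ * τ → ρ 0 x = ρbar ∧ u 0 x = 0) :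
    ∀ x, ‖x - x₀‖ < σ * (τ - t₀) → ρ t₀ x = ρbar ∧ u t₀ x = 0 := by
  obtain ⟨δ, hδ, h, hh, hflux⟩ := exists_entropy_flux_bound hA hγ hρbar hσ hσc
  have hsub : Icc 0 t₀ ⊆ timeInterval T := fun s hs => mem_timeInterval_of_le ht₀ hs.1 hs.2
  have hK : IsCompact (Icc 0 t₀ ×ˢ Metric.closedBall x₀ (σ * τ)) :=
    isCompact_Icc.prod (isCompact_closedBall _ _)
  have hpair : ContinuousOn (fun z : ℝ × Space n => (ρ z.1 z.2, u z.1 z.2))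
      (Icc 0 t₀ ×ˢ Metric.closedBall x₀ (σ * τ)) :=
    (sol.density_C1.continuousOn.prodMk sol.velocity_C1.continuousOn).mono
      (prod_mono hsub (subset_univ _))
  -- a time step on which a solution at rest at its beginning stays close to rest
  obtain ⟨s, hs, hunif⟩ := Metric.uniformContinuousOn_iff.1
    (hK.uniformContinuousOn_of_continuous hpair) δ hδ
  have hstep : ∀ k : ℕ, ∀ t ∈ Icc 0 (min (k * (s / 2)) t₀), ∀ x, ‖x - x₀‖ < σ * (τ - t) →
      ρ t x = ρbar ∧ u t x = 0 := by
    intro k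
    induction k with
    | zero =>
      intro t ht x hx
      have h1 := ht.2.trans (min_le_left _ _)
      simp only [Nat.cast_zero, zero_mul] at h1
      have h2 : t = 0 := le_antisymm h1 ht.1
      subst h2
      exact hrest x (by simpa using hx)
    | succ k ih =>
      set t₁ := min (k * (s / 2)) t₀ with ht₁
      set t₂ := min ((k + 1 : ℕ) * (s / 2)) t₀ with ht₂
      have h01 : 0 ≤ t₁ := le_min (by positivity) ht₀.1
      have h20 : t₂ ≤ t₀ := min_le_right _ _
      have hlen : t₂ ≤ t₁ + s / 2 := by
        rw [ht₁, ← min_add_add_right]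
        refine min_le_min (le_of_eq (by push_cast; ring)) (by linarith)
      have hrest₁ := ih t₁ (right_mem_Icc.2 h01)
      intro t ht x hx
      rcases le_total t t₁ with hle | hle
      · exact ih t ⟨ht.1, hle⟩ x hx
      have h2T : t₂ ∈ timeInterval T := hsub ⟨ht.1.trans ht.2, h20⟩
      refine sol.rest_of_close hγ hρbar hmu hσ hh hflux h01 h2T (h20.trans_lt hτ) ?_ hrest₁
        t ⟨hle, ht.2⟩ x hx
      intro r hr y hy
      have hy₁ : ‖y - x₀‖ < σ * (τ - t₁) := by nlinarith [hr.1]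
      have hyK : y ∈ Metric.closedBall x₀ (σ * τ) := by
        rw [mem_closedBall_iff_norm]; nlinarith
      have hd := hunif (r, y) ⟨⟨h01.trans hr.1, hr.2.trans h20⟩, hyK⟩ (t₁, y)
        ⟨⟨h01, min_le_right _ _⟩, hyK⟩ (by
          rw [Prod.dist_eq, dist_self, Real.dist_eq, max_eq_left (abs_nonneg _),
            abs_of_nonneg (by linarith [hr.1])]
          linarith [hr.2])
      obtain ⟨e1, e2⟩ := hrest₁ y hy₁
      simp only [e1, e2, Prod.dist_eq, max_lt_iff] at hd
      exact ⟨by simpa [Real.dist_eq] using hd.1, by simpa using hd.2⟩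
  obtain ⟨k, hk⟩ := exists_nat_ge (t₀ / (s / 2))
  have hk' : t₀ ≤ k * (s / 2) := by rwa [div_le_iff₀ (by positivity)] at hk
  exact hstep k t₀ ⟨ht₀.1, le_min hk' le_rfl⟩

/-- Finite speed of propagation: the perturbation of the state of rest travels at most at the sound
speed `c` of that state. -/
lemma finite_speed (sol : IsC1Solution A γ mu lam ρbar ρ₀ u₀ ε T ρ u) (hA : 0 < A)
    (hγ : 1 < γ) (hρbar : 0 < ρbar) (hmu : 0 ≤ mu) {c : ℝ} (hc : 0 < c)
    (hc2 : c ^ 2 = A * γ * ρbar ^ (γ - 1)) {R : ℝ}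
    (hdata : ∀ x, R < ‖x‖ → ρ₀ x = 0 ∧ u₀ x = 0) {t : ℝ} (ht : t ∈ timeInterval T)
    {x : Space n} (hx : R + c * t < ‖x‖) : ρ t x = ρbar ∧ u t x = 0 := by
  obtain ⟨e, he, hlt⟩ : ∃ e > 0, R + (c + e) * (t + e) < ‖x‖ := by
    have h1 : Tendsto (fun e : ℝ => R + (c + e) * (t + e)) (𝓝 0) (𝓝 (R + (c + 0) * (t + 0))) :=
      Continuous.tendsto (by fun_prop) 0
    have h2 := h1.eventually (eventually_lt_nhds
      (show R + (c + 0) * (t + 0) < ‖x‖ by simpa using hx))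
    have h3 := (h2.filter_mono nhdsWithin_le_nhds).and
      (self_mem_nhdsWithin (a := (0 : ℝ)) (s := Ioi 0))
    obtain ⟨e, h4, h5⟩ := h3.exists
    exact ⟨e, h5, h4⟩
  refine sol.rest_in_cone hA hγ hρbar hmu (σ := c + e) (by linarith) (by rw [← hc2]; nlinarith)
    (x₀ := x) (τ := t + e) ht (by linarith) ?_ x (by simpa using by positivity)
  intro y hy
  have h1 : R < ‖y‖ := by
    have := norm_sub_norm_le x y
    rw [norm_sub_rev] at hy
    linarith
  obtain ⟨e1, e2⟩ := hdata y h1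
  rw [sol.density_init, sol.velocity_init, e1, e2]
  simp

end IsC1Solution

end DampedEuler

/-! ### The Yordanov–Zhang function -/

namespace DampedEuler

open Filter Topology

variable {n : ℕ}

lemma unitBallVolume_pos (n : ℕ) : 0 < unitBallVolume n :=
  div_pos (Real.rpow_pos_of_pos Real.pi_pos _) (Real.Gamma_pos_of_pos (by positivity))

/-- In every dimension `phi` is a superposition of exponentials with unit directions; in dimension
one the directions are the two signs. -/
lemma exists_measure_phi_eq (hn : 1 ≤ n) :
    ∃ ν : Measure (Space n), IsFiniteMeasure ν ∧ (∀ᵐ σ ∂ν, ‖σ‖ = 1) ∧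
      ∀ x, phi n x = ∫ σ, Real.exp (inner ℝ x σ) ∂ν := by
  by_cases h1 : n = 1
  · subst h1
    set e : Space 1 := EuclideanSpace.single 0 1 with he
    have hen : ‖e‖ = 1 := by simp [he]
    refine ⟨ENNReal.ofReal (1 / 2) • (Measure.dirac e + Measure.dirac (-e)), ?_, ?_, ?_⟩
    · exact Measure.smul_finite _ ENNReal.ofReal_ne_top
    · refine Measure.ae_smul_measure ?_ _
      rw [ae_add_measure_iff]
      constructor
      · rw [ae_dirac_eq]; exact hen
      · rw [ae_dirac_eq]; simpa using hen
    · intro x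
      have hx : ‖x‖ = |x 0| := by
        rw [EuclideanSpace.norm_eq]; simp [Real.sqrt_sq_eq_abs]
      rw [integral_smul_measure, integral_add_measure (integrable_dirac (by simp))
        (integrable_dirac (by simp)), integral_dirac, integral_dirac, phi, if_pos rfl, hx,
        Real.cosh_abs, Real.cosh_eq]
      simp [he, EuclideanSpace.inner_single_right]
      ring
  · set c : ℝ := 1 / (n * unitBallVolume n) with hc
    have hc0 : 0 ≤ c := by have := unitBallVolume_pos n; positivity
    refine ⟨ENNReal.ofReal c • Measure.map Subtype.val (volume : Measure (Space n)).toSphere,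
      ?_, ?_, ?_⟩
    · exact Measure.smul_finite _ ENNReal.ofReal_ne_top
    · refine Measure.ae_smul_measure ?_ _
      rw [ae_map_iff measurable_subtype_coe.aemeasurable
        (measurableSet_eq_fun (by fun_prop) (by fun_prop))]
      exact Eventually.of_forall fun σ => by simp
    · intro x
      rw [integral_smul_measure, integral_map measurable_subtype_coe.aemeasurable
        (by fun_prop), phi, if_neg h1, ENNReal.toReal_ofReal hc0, smul_eq_mul]

/-- The superposition `x ↦ ∫ h(σ) e^(x·σ) dν(σ)` of exponentials. -/
noncomputable def expIntegral (ν : Measure (Space n)) (h : Space n → ℝ) (x : Space n) : ℝ :=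
  ∫ σ, h σ * Real.exp (inner ℝ x σ) ∂ν

lemma abs_apply_le_norm (x : Space n) (j : Fin n) : |x j| ≤ ‖x‖ := by
  simpa using PiLp.norm_apply_le x j

lemma ae_abs_mul_coord_le {ν : Measure (Space n)} {h : Space n → ℝ} (hν : ∀ᵐ σ ∂ν, ‖σ‖ = 1)
    (hb : ∀ᵐ σ ∂ν, |h σ| ≤ 1) (j : Fin n) : ∀ᵐ σ ∂ν, |h σ * σ j| ≤ 1 := by
  filter_upwards [hν, hb] with σ h1 h2
  rw [abs_mul]
  exact mul_le_one₀ h2 (abs_nonneg _) (h1 ▸ abs_apply_le_norm σ j)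

section ExpIntegral

variable {ν : Measure (Space n)} [IsFiniteMeasure ν] {h : Space n → ℝ}

lemma integrable_expIntegral (hν : ∀ᵐ σ ∂ν, ‖σ‖ = 1) (hh : Continuous h)
    (hb : ∀ᵐ σ ∂ν, |h σ| ≤ 1) (x : Space n) :
    Integrable (fun σ => h σ * Real.exp (inner ℝ x σ)) ν := by
  refine Integrable.of_bound (C := Real.exp ‖x‖) (by fun_prop) ?_
  filter_upwards [hν, hb] with σ h1 h2
  rw [norm_mul, Real.norm_eq_abs, Real.norm_eq_abs, Real.abs_exp]
  have h3 : inner ℝ x σ ≤ ‖x‖ := by simpa [h1] using real_inner_le_norm x σ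
  calc |h σ| * Real.exp (inner ℝ x σ) ≤ 1 * Real.exp ‖x‖ :=
        mul_le_mul h2 (Real.exp_le_exp.2 h3) (Real.exp_pos _).le zero_le_one
    _ = _ := one_mul _

lemma hasFDerivAt_expIntegral (hν : ∀ᵐ σ ∂ν, ‖σ‖ = 1) (hh : Continuous h)
    (hb : ∀ᵐ σ ∂ν, |h σ| ≤ 1) (x : Space n) :
    Integrable (fun σ => (h σ * Real.exp (inner ℝ x σ)) • innerSL ℝ σ) ν ∧
    HasFDerivAt (expIntegral ν h)
      (∫ σ, (h σ * Real.exp (inner ℝ x σ)) • innerSL ℝ σ ∂ν) x := by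
  have hbound : ∀ᵐ σ ∂ν, ∀ y ∈ Metric.ball x 1,
      ‖(h σ * Real.exp (inner ℝ y σ)) • innerSL ℝ σ‖ ≤ Real.exp (‖x‖ + 1) := by
    filter_upwards [hν, hb] with σ h1 h2 y hy
    rw [norm_smul, innerSL_apply_norm, h1, mul_one, norm_mul, Real.norm_eq_abs, Real.norm_eq_abs,
      Real.abs_exp]
    have h3 : inner ℝ y σ ≤ ‖x‖ + 1 := by
      have h4 : inner ℝ y σ ≤ ‖y‖ := by simpa [h1] using real_inner_le_norm y σ
      have h5 := norm_le_norm_add_norm_sub x y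
      rw [mem_ball_iff_norm, norm_sub_rev] at hy
      linarith
    calc |h σ| * Real.exp (inner ℝ y σ) ≤ 1 * Real.exp (‖x‖ + 1) :=
          mul_le_mul h2 (Real.exp_le_exp.2 h3) (Real.exp_pos _).le zero_le_one
      _ = _ := one_mul _
  have hmeas : AEStronglyMeasurable
      (fun σ => (h σ * Real.exp (inner ℝ x σ)) • innerSL ℝ σ) ν := by
    have : Continuous fun σ : Space n => (h σ * Real.exp (inner ℝ x σ)) • innerSL ℝ σ :=
      (by fun_prop : Continuous fun σ : Space n => h σ * Real.exp (inner ℝ x σ)).smul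
        (innerSL ℝ).continuous
    exact this.aestronglyMeasurable
  refine ⟨Integrable.of_bound (C := Real.exp (‖x‖ + 1)) hmeas
    (hbound.mono fun σ hσ => hσ x (Metric.mem_ball_self one_pos)), ?_⟩
  refine hasFDerivAt_integral_of_dominated_of_fderiv_le
    (F := fun y σ => h σ * Real.exp (inner ℝ y σ)) (bound := fun _ => Real.exp (‖x‖ + 1))
    (Metric.ball_mem_nhds x one_pos) (Eventually.of_forall fun y => by fun_prop)
    (integrable_expIntegral hν hh hb x) hmeas hbound (integrable_const _)
    (Eventually.of_forall fun σ y _ => ?_)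
  have h1 : HasFDerivAt (fun y : Space n => inner ℝ y σ) (innerSL ℝ σ) y := by
    refine (innerSL ℝ σ).hasFDerivAt.congr_of_eventuallyEq (Eventually.of_forall fun z => ?_)
    simp [real_inner_comm]
  have h2 := (h1.exp).const_mul (h σ)
  rwa [smul_smul] at h2

lemma partialDeriv_expIntegral (hν : ∀ᵐ σ ∂ν, ‖σ‖ = 1) (hh : Continuous h)
    (hb : ∀ᵐ σ ∂ν, |h σ| ≤ 1) (j : Fin n) :
    partialDeriv j (expIntegral ν h) = expIntegral ν (fun σ => h σ * σ j) := by
  funext x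
  obtain ⟨h1, h2⟩ := hasFDerivAt_expIntegral hν hh hb x
  rw [partialDeriv, h2.fderiv, ContinuousLinearMap.integral_apply h1, expIntegral]
  refine integral_congr_ae (Eventually.of_forall fun σ => ?_)
  simp [EuclideanSpace.inner_single_right]
  ring

lemma continuous_expIntegral (hν : ∀ᵐ σ ∂ν, ‖σ‖ = 1) (hh : Continuous h)
    (hb : ∀ᵐ σ ∂ν, |h σ| ≤ 1) : Continuous (expIntegral ν h) :=
  continuous_iff_continuousAt.2 fun x => (hasFDerivAt_expIntegral hν hh hb x).2.continuousAt

lemma contDiff_expIntegral (hν : ∀ᵐ σ ∂ν, ‖σ‖ = 1) (hh : Continuous h)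
    (hb : ∀ᵐ σ ∂ν, |h σ| ≤ 1) : ContDiff ℝ 1 (expIntegral ν h) := by
  refine contDiff_one_iff_fderiv.2
    ⟨fun x => (hasFDerivAt_expIntegral hν hh hb x).2.differentiableAt, ?_⟩
  refine continuous_clm_apply.2 fun v => ?_
  simp only [fderiv_eq_sum_partialDeriv]
  refine continuous_finsetSum _ fun j _ => continuous_const.mul ?_
  rw [partialDeriv_expIntegral hν hh hb j]
  exact continuous_expIntegral hν (by fun_prop) (ae_abs_mul_coord_le hν hb j)

end ExpIntegral

/-- An exponential with unit direction `σ` has mass `O(r^((n-1)/2) e^r)` on the ball of radius `r`: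
on the ball `|x'|² ≤ 2 r (r - x·σ)`, where `x'` is the part of `x` orthogonal to `σ`, so that
half of the decay of `e^(x·σ - r)` can be traded for a Gaussian in `x'`. -/
lemma setIntegral_exp_inner_le (hn : 1 ≤ n) {σ : Space n} (hσ : ‖σ‖ = 1) {r : ℝ} (hr : 0 < r) :
    ∫ x in Metric.closedBall (0 : Space n) r, Real.exp (inner ℝ x σ)
      ≤ Real.exp r * (8 * Real.pi * Real.sqrt (4 * Real.pi * r) ^ (n - 1)) := by
  set i₀ : Fin n := ⟨0, hn⟩ with hi₀
  obtain ⟨b, hb⟩ : ∃ b : OrthonormalBasis (Fin n) ℝ (Space n), b i₀ = σ := by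
    obtain ⟨b, hb⟩ := Orthonormal.exists_orthonormalBasis_extension_of_card_eq (𝕜 := ℝ)
      (E := Space n) (ι := Fin n) (by simp) (v := fun _ => σ) (s := {i₀})
      (by
        refine ⟨fun i => by simpa using hσ, fun i j hij => (hij ?_).elim⟩
        exact Subtype.ext (i.2.trans j.2.symm))
    exact ⟨b, hb i₀ rfl⟩
  set g : Fin n → ℝ → ℝ := fun i y =>
    if i = i₀ then 8 * (1 + (r - y) ^ 2)⁻¹ else Real.exp (-(1 / (4 * r)) * y ^ 2) with hg
  have hg0 : ∀ i y, 0 ≤ g i y := by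
    intro i y; rw [hg]; simp only; split_ifs <;> positivity
  have hr4 : 0 < 1 / (4 * r) := by positivity
  have hint : ∀ i, Integrable (g i) := by
    intro i
    by_cases h : i = i₀
    · simp only [hg, h, if_true]
      exact (integrable_inv_one_add_sq.comp_sub_left r).const_mul 8
    · simp only [hg, h, if_false]
      exact integrable_exp_neg_mul_sq hr4
  have hGint : Integrable (fun y : Fin n → ℝ => ∏ i, g i (y i)) :=
    Integrable.fintype_prod hint
  have hGval : ∫ y : Fin n → ℝ, ∏ i, g i (y i)
      = 8 * Real.pi * Real.sqrt (4 * Real.pi * r) ^ (n - 1) := by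
    rw [integral_fintype_prod_volume_eq_prod, ← Finset.mul_prod_erase _ _ (Finset.mem_univ i₀)]
    congr 1
    · simp only [hg, if_true]
      rw [integral_const_mul, integral_sub_left_eq_self (fun y : ℝ => (1 + y ^ 2)⁻¹) volume r,
        integral_univ_inv_one_add_sq]
    · rw [Finset.prod_congr rfl (g := fun _ => Real.sqrt (4 * Real.pi * r))]
      · simp
      · intro i hi
        simp only [hg, (Finset.mem_erase.1 hi).1, if_false]
        rw [integral_gaussian]
        congr 1
        field_simp
  have hT : MeasurePreserving (fun x : Space n => WithLp.ofLp (b.repr x)) volume volume :=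
    (PiLp.volume_preserving_ofLp (Fin n)).comp b.measurePreserving_repr
  have hTemb : MeasurableEmbedding (fun x : Space n => WithLp.ofLp (b.repr x)) :=
    (MeasurableEquiv.toLp 2 (Fin n → ℝ)).symm.measurableEmbedding.comp
      b.repr.toHomeomorph.measurableEmbedding
  have hpt : ∀ x ∈ Metric.closedBall (0 : Space n) r,
      Real.exp (inner ℝ x σ) ≤ Real.exp r * ∏ i, g i (b.repr x i) := by
    intro x hx
    rw [mem_closedBall_zero_iff] at hx
    set y := b.repr x with hy
    have hyn : ∑ i, y i ^ 2 ≤ r ^ 2 := by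
      rw [← EuclideanSpace.real_norm_sq_eq, hy, LinearIsometryEquiv.norm_map]
      exact pow_le_pow_left₀ (norm_nonneg _) hx 2
    have hy0 : inner ℝ x σ = y i₀ := by
      rw [hy, OrthonormalBasis.repr_apply_apply, hb, real_inner_comm]
    rw [← Finset.add_sum_erase _ _ (Finset.mem_univ i₀)] at hyn
    have hS : 0 ≤ ∑ i ∈ Finset.univ.erase i₀, y i ^ 2 := Finset.sum_nonneg fun i _ => sq_nonneg _
    obtain ⟨hl, hu⟩ := abs_le_of_sq_le_sq' (a := y i₀) (b := r) (by linarith) hr.le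
    rw [← Finset.mul_prod_erase _ _ (Finset.mem_univ i₀), hy0]
    have hprod : ∏ i ∈ Finset.univ.erase i₀, g i (y i)
        = Real.exp (-(1 / (4 * r)) * ∑ i ∈ Finset.univ.erase i₀, y i ^ 2) := by
      rw [Finset.mul_sum, Real.exp_sum]
      exact Finset.prod_congr rfl fun i hi => by simp only [hg, (Finset.mem_erase.1 hi).1, if_false]
    have hfirst : Real.exp (-((r - y i₀) / 2)) ≤ g i₀ (y i₀) := by
      simp only [hg, if_true]
      rw [Real.exp_neg, ← div_eq_mul_inv, inv_eq_one_div, div_le_div_iff₀ (Real.exp_pos _)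
        (by positivity)]
      have := Real.quadratic_le_exp_of_nonneg (x := (r - y i₀) / 2) (by linarith)
      nlinarith
    rw [hprod]
    calc Real.exp (y i₀) ≤ Real.exp r * (Real.exp (-((r - y i₀) / 2))
          * Real.exp (-(1 / (4 * r)) * ∑ i ∈ Finset.univ.erase i₀, y i ^ 2)) := by
          rw [← Real.exp_add, ← Real.exp_add, Real.exp_le_exp]
          have h1 : 1 / (4 * r) * ∑ i ∈ Finset.univ.erase i₀, y i ^ 2 ≤ (r - y i₀) / 2 := by
            rw [div_mul_eq_mul_div, one_mul, div_le_iff₀ (by positivity)]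
            nlinarith
          linarith
      _ ≤ _ := by gcongr
  have hcomp : Integrable (fun x : Space n => Real.exp r * ∏ i, g i (b.repr x i)) :=
    (hT.integrable_comp_of_integrable hGint).const_mul _
  calc ∫ x in Metric.closedBall (0 : Space n) r, Real.exp (inner ℝ x σ)
      ≤ ∫ x in Metric.closedBall (0 : Space n) r, Real.exp r * ∏ i, g i (b.repr x i) := by
        refine setIntegral_mono_on ?_ hcomp.integrableOn
          Metric.isClosed_closedBall.measurableSet hpt
        exact ContinuousOn.integrableOn_compact (isCompact_closedBall _ _)
          (Continuous.continuousOn (by fun_prop))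
    _ ≤ ∫ x : Space n, Real.exp r * ∏ i, g i (b.repr x i) :=
        setIntegral_le_integral hcomp (Eventually.of_forall fun x =>
          mul_nonneg (Real.exp_pos _).le (Finset.prod_nonneg fun i _ => hg0 i _))
    _ = _ := by
        rw [integral_const_mul, ← hGval, ← hT.integral_comp hTemb]

/-- The properties of the Yordanov–Zhang function used below: it is a nonnegative, `C²` (through its
partial derivatives), convex solution of `Δφ = φ`, and its mass on a ball of radius
`R + c t` is `O((1 + t)^((n-1)/2) e^(c t))`. The last bound fixes the time scale of the blow-up. -/
structure IsConvexEigenfunction (φ : Space n → ℝ) : Prop where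
  nonneg : ∀ x, 0 ≤ φ x
  contDiff : ContDiff ℝ 1 φ
  contDiff_partialDeriv : ∀ i, ContDiff ℝ 1 (partialDeriv i φ)
  laplacian : ∀ x, ∑ i, partialDeriv i (partialDeriv i φ) x = φ x
  hessian_nonneg : ∀ x (v : Space n),
    0 ≤ ∑ i, ∑ j, v i * v j * partialDeriv j (partialDeriv i φ) x
  ball_bound : ∀ R c : ℝ, 0 < R → 0 < c → ∃ C, 1 ≤ C ∧ ∀ t, 0 ≤ t →
    ∫ x in Metric.closedBall (0 : Space n) (R + c * t), φ x
      ≤ C * Real.exp (c * t) * (1 + t) ^ (((n : ℝ) - 1) / 2)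

lemma isConvexEigenfunction_phi (hn : 1 ≤ n) : IsConvexEigenfunction (phi n) := by
  obtain ⟨ν, hfin, hν, hφ⟩ := exists_measure_phi_eq hn
  have hφ' : phi n = expIntegral ν (fun _ => 1) := by
    funext x; rw [hφ, expIntegral]; simp
  have hb : ∀ᵐ σ ∂ν, |(fun _ : Space n => (1 : ℝ)) σ| ≤ 1 := Eventually.of_forall fun _ => by simp
  have hc : Continuous (fun _ : Space n => (1 : ℝ)) := continuous_const
  have hp : ∀ i, partialDeriv i (phi n) = expIntegral ν (fun σ => 1 * σ i) := fun i => by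
    rw [hφ', partialDeriv_expIntegral hν hc hb]
  have hbi := fun i => ae_abs_mul_coord_le hν hb i
  have hci : ∀ i, Continuous (fun σ : Space n => 1 * σ i) := fun i => by fun_prop
  have hpp : ∀ i j, partialDeriv j (partialDeriv i (phi n))
      = expIntegral ν (fun σ => 1 * σ i * σ j) := fun i j => by
    rw [hp, partialDeriv_expIntegral hν (hci i) (hbi i)]
  have hint2 : ∀ i j x, Integrable (fun σ => 1 * σ i * σ j * Real.exp (inner ℝ x σ)) ν :=
    fun i j x => integrable_expIntegral hν (by fun_prop) (ae_abs_mul_coord_le hν (hbi i) j) x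
  have hcφ : ContDiff ℝ 1 (phi n) := hφ' ▸ contDiff_expIntegral hν hc hb
  refine ⟨fun x => ?_, hcφ, fun i => ?_, fun x => ?_, fun x v => ?_, fun R c hR hc0 => ?_⟩
  · rw [hφ]; exact integral_nonneg fun σ => (Real.exp_pos _).le
  · rw [hp]; exact contDiff_expIntegral hν (hci i) (hbi i)
  · simp only [hpp, expIntegral]
    rw [← integral_finsetSum _ fun i _ => hint2 i i x, hφ]
    refine integral_congr_ae (hν.mono fun σ h1 => ?_)
    simp only
    rw [← Finset.sum_mul]
    have h2 := EuclideanSpace.real_norm_sq_eq σ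
    rw [h1] at h2
    have h3 : ∑ i, 1 * σ i * σ i = 1 := by
      rw [← one_pow 2, h2]; exact Finset.sum_congr rfl fun i _ => by ring
    rw [h3, one_mul]
  · simp only [hpp, expIntegral, ← integral_const_mul]
    have e1 : ∀ i, ∑ j, ∫ σ, v i * v j * (1 * σ i * σ j * Real.exp (inner ℝ x σ)) ∂ν
        = ∫ σ, ∑ j, v i * v j * (1 * σ i * σ j * Real.exp (inner ℝ x σ)) ∂ν := fun i =>
      (integral_finsetSum _ fun j _ => (hint2 i j x).const_mul _).symm
    rw [Finset.sum_congr rfl fun i _ => e1 i, ← integral_finsetSum _ fun i _ =>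
      integrable_finsetSum _ fun j _ => (hint2 i j x).const_mul _]
    refine integral_nonneg fun σ => ?_
    have e2 : ∑ i, ∑ j, v i * v j * (1 * σ i * σ j * Real.exp (inner ℝ x σ))
        = (∑ i, v i * σ i) * (∑ j, v j * σ j) * Real.exp (inner ℝ x σ) := by
      rw [Finset.sum_mul_sum, Finset.sum_mul]
      refine Finset.sum_congr rfl fun i _ => ?_
      rw [Finset.sum_mul]
      exact Finset.sum_congr rfl fun j _ => by ring
    simp only [Pi.zero_apply, e2]
    exact mul_nonneg (mul_self_nonneg _) (Real.exp_pos _).le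
  · set m := max R c with hm
    have hm0 : 0 < m := lt_of_lt_of_le hR (le_max_left _ _)
    set K := ν.real univ * (Real.exp R * (8 * Real.pi * Real.sqrt (4 * Real.pi * m) ^ (n - 1)))
      with hK
    refine ⟨max 1 K, le_max_left _ _, fun t ht => ?_⟩
    set r := R + c * t with hr
    have hr0 : 0 < r := by positivity
    set B := Metric.closedBall (0 : Space n) r with hB
    have hprod : Integrable (Function.uncurry fun x σ : Space n => Real.exp (inner ℝ x σ))
        ((volume.restrict B).prod ν) := by
      rw [integrable_prod_iff (Continuous.aestronglyMeasurable (by fun_prop))]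
      constructor
      · refine Eventually.of_forall fun x => ?_
        simpa using integrable_expIntegral hν hc hb x
      · have : (fun x : Space n => ∫ σ, ‖Function.uncurry
            (fun x σ : Space n => Real.exp (inner ℝ x σ)) (x, σ)‖ ∂ν) = phi n := by
          funext x; simp [hφ]
        rw [this]
        exact hcφ.continuous.continuousOn.integrableOn_compact (isCompact_closedBall _ _)
    have h1 : ∫ x in B, phi n x
        ≤ ν.real univ * (Real.exp r * (8 * Real.pi * Real.sqrt (4 * Real.pi * r) ^ (n - 1))) := by
      calc ∫ x in B, phi n x = ∫ x in B, (∫ σ, Real.exp (inner ℝ x σ) ∂ν) := by simp only [hφ]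
        _ = ∫ σ, (∫ x in B, Real.exp (inner ℝ x σ)) ∂ν := integral_integral_swap hprod
        _ ≤ ∫ σ, Real.exp r * (8 * Real.pi * Real.sqrt (4 * Real.pi * r) ^ (n - 1)) ∂ν :=
            integral_mono_ae hprod.integral_prod_right (integrable_const _)
              (hν.mono fun σ hσ => setIntegral_exp_inner_le hn hσ hr0)
        _ = _ := by rw [integral_const, smul_eq_mul]
    have hrm : r ≤ m * (1 + t) := by
      have e1 : R ≤ m := le_max_left _ _
      have e2 : c ≤ m := le_max_right _ _
      rw [hr]; nlinarith
    have hsq : Real.sqrt (4 * Real.pi * r) ^ (n - 1)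
        ≤ Real.sqrt (4 * Real.pi * m) ^ (n - 1) * (1 + t) ^ (((n : ℝ) - 1) / 2) := by
      have e1 : Real.sqrt (4 * Real.pi * r) ≤ Real.sqrt (4 * Real.pi * m) * Real.sqrt (1 + t) := by
        rw [← Real.sqrt_mul (by positivity)]
        refine Real.sqrt_le_sqrt ?_
        rw [mul_assoc (4 * Real.pi)]
        gcongr
      have e2 : Real.sqrt (1 + t) ^ (n - 1) = (1 + t) ^ (((n : ℝ) - 1) / 2) := by
        rw [Real.sqrt_eq_rpow, ← Real.rpow_natCast, ← Real.rpow_mul (by linarith),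
          Nat.cast_sub hn]
        congr 1
        push_cast
        ring
      rw [← e2, ← mul_pow]
      exact pow_le_pow_left₀ (Real.sqrt_nonneg _) e1 _
    refine h1.trans ?_
    have e3 : ν.real univ * (Real.exp r * (8 * Real.pi * Real.sqrt (4 * Real.pi * r) ^ (n - 1)))
        ≤ K * Real.exp (c * t) * (1 + t) ^ (((n : ℝ) - 1) / 2) := by
      calc _ ≤ ν.real univ * (Real.exp r * (8 * Real.pi * (Real.sqrt (4 * Real.pi * m) ^ (n - 1)
            * (1 + t) ^ (((n : ℝ) - 1) / 2)))) := by gcongr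
        _ = _ := by rw [hr, Real.exp_add, hK]; ring
    refine e3.trans ?_
    gcongr
    exact le_max_right _ _

end DampedEuler

/-! ### Blow-up for the system of differential inequalities -/

namespace DampedEuler

open Filter Topology

/-- Positivity for a cooperative system: `W' ≥ m V - 2 c W` where `V > 0`, and `V' ≥ 0` where
`W > 0`. -/
lemma pos_of_coupled_system {W V W' V' : ℝ → ℝ} {m c b : ℝ} (hm : 0 < m)
    (hW : ContinuousOn W (Icc 0 b)) (hV : ContinuousOn V (Icc 0 b))
    (hWd : ∀ t ∈ Ioo 0 b, HasDerivAt W (W' t) t) (hVd : ∀ t ∈ Ioo 0 b, HasDerivAt V (V' t) t)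
    (hW0 : 0 < W 0) (hV0 : 0 < V 0)
    (hW' : ∀ t ∈ Ioo 0 b, 0 < V t → m * V t - 2 * c * W t ≤ W' t)
    (hV' : ∀ t ∈ Ioo 0 b, 0 < W t → 0 ≤ V' t) : ∀ t ∈ Icc 0 b, 0 < W t := by
  by_contra hcon
  push Not at hcon
  set S : Set ℝ := Icc 0 b ∩ W ⁻¹' Iic 0 with hS
  have hSne : S.Nonempty := by
    obtain ⟨t, ht, hWt⟩ := hcon
    exact ⟨t, ht, hWt⟩
  have hScl : IsClosed S := hW.preimage_isClosed_of_isClosed isClosed_Icc isClosed_Iic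
  have hSbd : BddBelow S := ⟨0, fun t ht => ht.1.1⟩
  set t₁ := sInf S with ht₁
  have hmem : t₁ ∈ S := hScl.csInf_mem hSne hSbd
  have hpos : ∀ t ∈ Ico 0 t₁, 0 < W t := by
    intro t ht
    by_contra hle
    exact absurd (csInf_le hSbd ⟨⟨ht.1, ht.2.le.trans hmem.1.2⟩, not_lt.1 hle⟩) (not_le.2 ht.2)
  have h01 : 0 ≤ t₁ := hmem.1.1
  have hsub : Icc 0 t₁ ⊆ Icc 0 b := Icc_subset_Icc_right hmem.1.2
  have hsubo : Ioo 0 t₁ ⊆ Ioo 0 b := Ioo_subset_Ioo_right hmem.1.2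
  have hVmono : MonotoneOn V (Icc 0 t₁) := by
    refine monotoneOn_of_deriv_nonneg (convex_Icc _ _) (hV.mono hsub) ?_ ?_ <;> rw [interior_Icc]
    · exact fun t ht => (hVd t (hsubo ht)).differentiableAt.differentiableWithinAt
    · intro t ht
      rw [(hVd t (hsubo ht)).deriv]
      exact hV' t (hsubo ht) (hpos t ⟨ht.1.le, ht.2⟩)
  have hYd : ∀ t ∈ Ioo 0 t₁, HasDerivAt (fun t => Real.exp (2 * c * t) * W t)
      (Real.exp (2 * c * t) * (W' t + 2 * c * W t)) t := by
    intro t ht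
    have h1 : HasDerivAt (fun t : ℝ => Real.exp (2 * c * t))
        (Real.exp (2 * c * t) * (2 * c)) t := by
      simpa using ((hasDerivAt_id t).const_mul (2 * c)).exp
    refine (h1.mul (hWd t (hsubo ht))).congr_deriv ?_
    ring
  have hYmono : MonotoneOn (fun t => Real.exp (2 * c * t) * W t) (Icc 0 t₁) := by
    refine monotoneOn_of_deriv_nonneg (convex_Icc _ _)
      ((Continuous.continuousOn (by fun_prop)).mul (hW.mono hsub)) ?_ ?_ <;> rw [interior_Icc]
    · exact fun t ht => (hYd t ht).differentiableAt.differentiableWithinAt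
    · intro t ht
      rw [(hYd t ht).deriv]
      refine mul_nonneg (Real.exp_pos _).le ?_
      have h1 := hVmono (left_mem_Icc.2 h01) ⟨ht.1.le, ht.2.le⟩ ht.1.le
      have h2 := hW' t (hsubo ht) (hV0.trans_le h1)
      nlinarith [mul_pos hm hV0]
  have h3 := hYmono (left_mem_Icc.2 h01) (right_mem_Icc.2 h01) h01
  simp only [mul_zero, Real.exp_zero, one_mul] at h3
  have h4 : W t₁ ≤ 0 := hmem.2
  nlinarith [Real.exp_pos (2 * c * t₁)]

/-- The profile of the explicit subsolution: the blow-up rate `s⁻¹` of the quadratic first-order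
equation for large `s`, and for small `s` a faster rate, compatible with the second-order equation
with nonlinearity `z ^ (1 + 1 / k)`. -/
noncomputable def profile (k : ℕ) (s : ℝ) : ℝ := s⁻¹ + s⁻¹ ^ (2 * k)

/-- Minus the derivative of `profile`. -/
noncomputable def profileSlope (k : ℕ) (s : ℝ) : ℝ := s⁻¹ ^ 2 + (2 * k : ℝ) * s⁻¹ ^ (2 * k + 1)

/-- The second derivative of `profile`. -/
noncomputable def profileCurv (k : ℕ) (s : ℝ) : ℝ :=
  2 * s⁻¹ ^ 3 + (2 * k : ℝ) * (2 * k + 1) * s⁻¹ ^ (2 * k + 2)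

lemma hasDerivAt_inv_pow (m : ℕ) {s : ℝ} (hs : s ≠ 0) :
    HasDerivAt (fun s : ℝ => s⁻¹ ^ m) (-(m * s⁻¹ ^ (m + 1))) s := by
  refine ((hasDerivAt_inv hs).fun_pow m).congr_deriv ?_
  cases m with
  | zero => simp
  | succ m =>
    rw [Nat.add_sub_cancel, ← inv_pow]
    ring

lemma hasDerivAt_profile (k : ℕ) {s : ℝ} (hs : s ≠ 0) :
    HasDerivAt (profile k) (-profileSlope k s) s := by
  have h1 := (hasDerivAt_inv_pow 1 hs).add (hasDerivAt_inv_pow (2 * k) hs)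
  refine (h1.congr_of_eventuallyEq (Eventually.of_forall fun r => ?_)).congr_deriv ?_
  · simp [profile]
  · simp only [profileSlope]; push_cast; ring

lemma hasDerivAt_profileSlope (k : ℕ) {s : ℝ} (hs : s ≠ 0) :
    HasDerivAt (profileSlope k) (-profileCurv k s) s := by
  have h1 := (hasDerivAt_inv_pow 2 hs).add
    ((hasDerivAt_inv_pow (2 * k + 1) hs).const_mul (2 * k : ℝ))
  refine (h1.congr_of_eventuallyEq (Eventually.of_forall fun r => ?_)).congr_deriv ?_
  · simp [profileSlope]
  · simp only [profileCurv]; push_cast; ring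

lemma profileSlope_nonneg (k : ℕ) {s : ℝ} (hs : 0 < s) : 0 ≤ profileSlope k s := by
  unfold profileSlope; positivity

lemma profile_pos (k : ℕ) {s : ℝ} (hs : 0 < s) : 0 < profile k s := by
  unfold profile; positivity

/-- Both derivatives of the profile are controlled by the nonlinearity. -/
lemma profile_derivs_le_gain {k : ℕ} (hk : 1 ≤ k) {s : ℝ} (hs : 0 < s) :
    profileSlope k s ≤ (2 + 2 * k * (2 * k + 1)) * gain k (profile k s) ∧
    profileCurv k s ≤ (2 + 2 * k * (2 * k + 1)) * gain k (profile k s) := by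
  unfold profileSlope profileCurv profile
  have hv : 0 < s⁻¹ := inv_pos.2 hs
  generalize s⁻¹ = v at hv
  have hk1 : (1 : ℝ) ≤ k := by exact_mod_cast hk
  -- `e` is the exponent of the dominant power of `v`
  obtain ⟨e, h2, h3, h21, h22, hg⟩ : ∃ e : ℕ, v ^ 2 ≤ v ^ e ∧ v ^ 3 ≤ v ^ e ∧
      v ^ (2 * k + 1) ≤ v ^ e ∧ v ^ (2 * k + 2) ≤ v ^ e ∧ v ^ e ≤ gain k (v + v ^ (2 * k)) := by
    rcases le_total v 1 with h | h
    · have hp : ∀ m : ℕ, 2 ≤ m → v ^ m ≤ v ^ 2 := fun m hm => pow_le_pow_of_le_one hv.le h hm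
      refine ⟨2, le_rfl, hp 3 (by omega), hp _ (by omega), hp _ (by omega), ?_⟩
      refine le_trans ?_ (gain_mono k hv.le (le_add_of_nonneg_right (by positivity)))
      have h1 : v ≤ v ^ (1 / k : ℝ) := by
        conv_lhs => rw [← Real.rpow_one v]
        exact Real.rpow_le_rpow_of_exponent_ge hv h (by rw [div_le_one (by linarith)]; exact hk1)
      rw [gain, min_eq_left h1, sq]
    · have hp : ∀ m : ℕ, m ≤ 2 * k + 2 → v ^ m ≤ v ^ (2 * k + 2) :=
        fun m hm => pow_le_pow_right₀ h hm
      refine ⟨2 * k + 2, hp 2 (by omega), hp 3 (by omega), hp _ (by omega), le_rfl, ?_⟩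
      refine le_trans ?_ (gain_mono k (s := v ^ (2 * k)) (by positivity)
        (le_add_of_nonneg_left hv.le))
      have h1 : (v ^ (2 * k)) ^ (1 / k : ℝ) = v ^ 2 := by
        rw [pow_mul, one_div]
        exact Real.pow_rpow_inv_natCast (by positivity) (by omega)
      rw [gain, h1, min_eq_right (pow_le_pow_right₀ h (by omega)), ← pow_add]
  have hg0 : 0 ≤ gain k (v + v ^ (2 * k)) := gain_nonneg k (by positivity)
  have hkk : 0 ≤ (2 * k : ℝ) * (2 * k + 1) := by positivity
  constructor
  · nlinarith [mul_le_mul_of_nonneg_left (h21.trans hg) (show (0 : ℝ) ≤ 2 * k by positivity),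
      mul_nonneg (show (0 : ℝ) ≤ 1 + 4 * k ^ 2 by positivity) hg0]
  · nlinarith [mul_le_mul_of_nonneg_left (h22.trans hg) hkk]

/-- The second component of the subsolution grows at most as fast as the nonlinearity allows, if
time is slowed down by a small factor `δ`. -/
lemma subsolution_rate_le {k : ℕ} (hk : 1 ≤ k) {c m κ δ f s : ℝ} (hc : 0 < c) (hm : 0 < m)
    (hδ0 : 0 < δ) (hδ1 : δ ≤ 1)
    (hδ : δ * ((1 + 2 * c) * (2 + 2 * k * (2 * k + 1))) ≤ m * κ) (hf : 0 < f) (hs : 0 < s) :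
    (δ * (δ * f * profileCurv k s) + 2 * c * (δ * f * profileSlope k s)) / m
      ≤ κ * f * gain k (profile k s) := by
  obtain ⟨d1, d2⟩ := profile_derivs_le_gain hk hs
  have hG0 := gain_nonneg k (profile_pos k hs).le
  set G := gain k (profile k s) with hG
  set E : ℝ := 2 + 2 * k * (2 * k + 1) with hE
  have hE0 : 0 < E := by positivity
  have h2 : δ * profileCurv k s + 2 * c * profileSlope k s ≤ (1 + 2 * c) * E * G := by
    have e1 : δ * profileCurv k s ≤ E * G :=
      (mul_le_mul_of_nonneg_left d2 hδ0.le).trans (mul_le_of_le_one_left (by positivity) hδ1)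
    have e2 := mul_le_mul_of_nonneg_left d1 (show 0 ≤ 2 * c by positivity)
    linarith
  rw [div_le_iff₀ hm]
  calc δ * (δ * f * profileCurv k s) + 2 * c * (δ * f * profileSlope k s)
      = δ * f * (δ * profileCurv k s + 2 * c * profileSlope k s) := by ring
    _ ≤ δ * f * ((1 + 2 * c) * E * G) := mul_le_mul_of_nonneg_left h2 (by positivity)
    _ = δ * ((1 + 2 * c) * E) * (f * G) := by ring
    _ ≤ m * κ * (f * G) := mul_le_mul_of_nonneg_right hδ (by positivity)
    _ = κ * f * G * m := by ring

/-- The subsolution starts below data of size `ε` if its life is of length a large multiple of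
`1 / ε`. -/
lemma exists_subsolution_initial {k : ℕ} (hk : 1 ≤ k) {c m z : ℝ} (hc : 0 < c) (hm : 0 < m)
    (hz : 0 < z) : ∃ C > 0, ∀ ε, 0 < ε → ε ≤ 1 →
      profile k (C / ε) < z * ε ∧ ∀ δ, 0 < δ → δ ≤ 1 →
        (δ * profileSlope k (C / ε) + 2 * c * profile k (C / ε)) / m < c * z * ε := by
  set C₀ : ℝ := 1 + 2 / z + ((1 + 2 * k) + 4 * c) / (m * c * z) with hC₀
  have hC₀0 : 0 < C₀ := by positivity
  refine ⟨C₀, hC₀0, fun ε hε hε1 => ?_⟩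
  set S : ℝ := C₀ / ε with hS
  have hS1 : 1 ≤ S := by
    rw [hS, le_div_iff₀ hε, one_mul]
    have h1 : 1 ≤ C₀ := by
      rw [hC₀, add_assoc]
      exact le_add_of_nonneg_right (by positivity)
    linarith
  have hS0 : 0 < S := by linarith
  have h1 : S⁻¹ ≤ 1 := inv_le_one_of_one_le₀ hS1
  have h0 : 0 < S⁻¹ := by positivity
  have h2 : ∀ p : ℕ, p ≠ 0 → S⁻¹ ^ p ≤ S⁻¹ := fun p hp => pow_le_of_le_one h0.le h1 hp
  have h3 : S⁻¹ = ε / C₀ := by rw [hS, inv_div]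
  have hP : profile k S ≤ 2 * S⁻¹ := by
    unfold profile; linarith [h2 (2 * k) (by omega)]
  have hD : profileSlope k S ≤ (1 + 2 * k) * S⁻¹ := by
    unfold profileSlope
    have := mul_le_mul_of_nonneg_left (h2 (2 * k + 1) (by omega))
      (show (0 : ℝ) ≤ 2 * k by positivity)
    linarith [h2 2 (by omega)]
  have hDn := profileSlope_nonneg k hS0
  constructor
  · refine lt_of_le_of_lt hP ?_
    rw [h3, ← mul_div_assoc, div_lt_iff₀ hC₀0]
    have h5 : 2 < z * C₀ := by
      have h6 : z * C₀ = z + 2 + z * (((1 + 2 * k) + 4 * c) / (m * c * z)) := by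
        rw [hC₀]; field_simp
      have : 0 ≤ z * (((1 + 2 * k) + 4 * c) / (m * c * z)) := by positivity
      linarith
    linarith [mul_lt_mul_of_pos_right h5 hε]
  · intro δ hδ0 hδ1
    have h4 : δ * profileSlope k S + 2 * c * profile k S ≤ ((1 + 2 * k) + 4 * c) * (ε / C₀) := by
      rw [← h3]
      have e1 : δ * profileSlope k S ≤ profileSlope k S := mul_le_of_le_one_left hDn hδ1
      have e2 := mul_le_mul_of_nonneg_left hP (show 0 ≤ 2 * c by positivity)
      linarith
    rw [div_lt_iff₀ hm]
    refine lt_of_le_of_lt h4 ?_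
    rw [← mul_div_assoc, div_lt_iff₀ hC₀0]
    have h6 : (1 + 2 * k) + 4 * c < m * c * z * C₀ := by
      have h7 : m * c * z * C₀ = m * c * z + 2 * m * c + ((1 + 2 * k) + 4 * c) := by
        rw [hC₀]; field_simp
      have : 0 < m * c * z + 2 * m * c := by positivity
      linarith
    linarith [mul_lt_mul_of_pos_right h6 hε]

/-- Blow-up for the first-order system satisfied by the functionals. The time scale is measured by
`τ = ∫ f`: data of size `ε` cannot be continued beyond `τ = C / ε`. -/
theorem exists_blowup_const {k : ℕ} (hk : 1 ≤ k) {c m κ z : ℝ} (hc : 0 < c) (hm : 0 < m)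
    (hκ : 0 < κ) (hz : 0 < z) :
    ∃ C > 0, ∀ ε, 0 < ε → ε ≤ 1 → ∀ (f τ Z Q Z' Q' : ℝ → ℝ) (b : ℝ), 0 ≤ b →
      (∀ t ∈ Ioo 0 b, 0 < f t ∧ f t ≤ 1) → (∀ t ∈ Ioo 0 b, HasDerivAt τ (f t) t) →
      ContinuousOn τ (Icc 0 b) → τ 0 = 0 → C / ε ≤ τ b →
      ContinuousOn Z (Icc 0 b) → ContinuousOn Q (Icc 0 b) →
      (∀ t ∈ Ioo 0 b, HasDerivAt Z (Z' t) t) → (∀ t ∈ Ioo 0 b, HasDerivAt Q (Q' t) t) →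
      (∀ t ∈ Ioo 0 b, 0 ≤ Q t → m * Q t - 2 * c * Z t ≤ Z' t) →
      (∀ t ∈ Ioo 0 b, 0 ≤ Z t → κ * f t * gain k (Z t) ≤ Q' t) →
      z * ε ≤ Z 0 → c * z * ε ≤ Q 0 → False := by
  have hk0 : (0 : ℝ) ≤ k := Nat.cast_nonneg k
  set E : ℝ := 2 + 2 * k * (2 * k + 1) with hE
  have hE0 : 0 < E := by positivity
  set δ : ℝ := min 1 (m * κ / ((1 + 2 * c) * E)) with hδ
  have hδ0 : 0 < δ := lt_min one_pos (by positivity)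
  have hδ1 : δ ≤ 1 := min_le_left _ _
  have hδE : δ * ((1 + 2 * c) * E) ≤ m * κ := by
    have := min_le_right 1 (m * κ / ((1 + 2 * c) * E))
    rwa [← hδ, le_div_iff₀ (by positivity)] at this
  obtain ⟨C₀, hC₀0, hinit⟩ := exists_subsolution_initial hk hc hm hz
  refine ⟨C₀ / δ, by positivity, ?_⟩
  intro ε hε hε1 f τ Z Q Z' Q' b hb hf hτ hτc hτ0 hτb hZc hQc hZ hQ hZ' hQ' hZ0 hQ0
  set S : ℝ := C₀ / ε with hS
  have hS0 : 0 < S := by positivity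
  obtain ⟨hi1, hi2⟩ := hinit ε hε hε1
  -- the subsolution is `profile k (S - δ τ)`; it blows up at the time `t₁` where `τ = S / δ`
  have hmono : StrictMonoOn τ (Icc 0 b) := by
    refine strictMonoOn_of_deriv_pos (convex_Icc _ _) hτc fun t ht => ?_
    rw [interior_Icc] at ht
    rw [(hτ t ht).deriv]
    exact (hf t ht).1
  obtain ⟨t₁, ht₁, hτ₁⟩ : S / δ ∈ τ '' Icc 0 b := by
    refine intermediate_value_Icc hb hτc ⟨by rw [hτ0]; positivity, ?_⟩
    rw [hS, div_right_comm]; exact hτb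
  have ht₁0 : 0 < t₁ := by
    rcases ht₁.1.eq_or_lt with h | h
    · rw [← h, hτ0] at hτ₁
      have : 0 < S / δ := by positivity
      linarith
    · exact h
  set s : ℝ → ℝ := fun t => S - δ * τ t with hs
  have hsc : ContinuousOn s (Icc 0 b) := continuousOn_const.sub (continuousOn_const.mul hτc)
  have hs₁ : s t₁ = 0 := by
    simp only [hs, hτ₁]; field_simp; ring
  have hspos : ∀ t ∈ Ico 0 t₁, 0 < s t := by
    intro t ht
    have h1 := hmono ⟨ht.1, ht.2.le.trans ht₁.2⟩ ht₁ ht.2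
    rw [← hs₁]
    simp only [hs]
    nlinarith
  have hsd : ∀ t ∈ Ioo 0 b, HasDerivAt s (-(δ * f t)) t := fun t ht =>
    ((hτ t ht).const_mul δ).const_sub S
  have hs0 : s 0 = S := by simp [hs, hτ0]
  -- comparison with the subsolution up to any time before `t₁`
  have hcomp : ∀ r ∈ Ico 0 t₁, profile k (s r) < Z r := by
    intro r hr
    have hrb : Icc 0 r ⊆ Icc 0 b := Icc_subset_Icc_right (hr.2.le.trans ht₁.2)
    have hrbo : Ioo 0 r ⊆ Ioo 0 b := Ioo_subset_Ioo_right (hr.2.le.trans ht₁.2)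
    have hsr : ∀ t ∈ Icc 0 r, 0 < s t := fun t ht => hspos t ⟨ht.1, ht.2.trans_lt hr.2⟩
    have hJc : ContinuousOn (fun t => profile k (s t)) (Icc 0 r) := fun t ht =>
      ((hasDerivAt_profile k (hsr t ht).ne').continuousAt.comp_continuousWithinAt
        ((hsc.mono hrb) t ht))
    have hDc : ContinuousOn (fun t => profileSlope k (s t)) (Icc 0 r) := fun t ht =>
      ((hasDerivAt_profileSlope k (hsr t ht).ne').continuousAt.comp_continuousWithinAt
        ((hsc.mono hrb) t ht))
    have hJd : ∀ t ∈ Ioo 0 r, HasDerivAt (fun t => profile k (s t))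
        (δ * f t * profileSlope k (s t)) t := fun t ht =>
      ((hasDerivAt_profile k (hsr t ⟨ht.1.le, ht.2.le⟩).ne').comp t (hsd t (hrbo ht))).congr_deriv
        (by ring)
    have hDd : ∀ t ∈ Ioo 0 r, HasDerivAt (fun t => profileSlope k (s t))
        (δ * f t * profileCurv k (s t)) t := fun t ht =>
      ((hasDerivAt_profileSlope k (hsr t ⟨ht.1.le, ht.2.le⟩).ne').comp t
        (hsd t (hrbo ht))).congr_deriv (by ring)
    have hW := pos_of_coupled_system (W := fun t => Z t - profile k (s t))
      (V := fun t => Q t - (δ * profileSlope k (s t) + 2 * c * profile k (s t)) / m)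
      (W' := fun t => Z' t - δ * f t * profileSlope k (s t))
      (V' := fun t => Q' t - (δ * (δ * f t * profileCurv k (s t))
        + 2 * c * (δ * f t * profileSlope k (s t))) / m) (m := m) (c := c) (b := r) hm
      ((hZc.mono hrb).sub hJc)
      ((hQc.mono hrb).sub (((continuousOn_const.mul hDc).add
        (continuousOn_const.mul hJc)).div_const m))
      (fun t ht => (hZ t (hrbo ht)).sub (hJd t ht))
      (fun t ht => (hQ t (hrbo ht)).sub ((((hDd t ht).const_mul δ).add
        ((hJd t ht).const_mul (2 * c))).div_const m)) ?_ ?_ ?_ ?_ r (right_mem_Icc.2 hr.1)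
    · linarith
    · simp only [hs0]
      linarith
    · simp only [hs0]
      linarith [hi2 δ hδ0 hδ1]
    · intro t ht hVt
      have hst := hsr t ⟨ht.1.le, ht.2.le⟩
      have hJ := profile_pos k hst
      have hD := profileSlope_nonneg k hst
      have hQs : 0 ≤ (δ * profileSlope k (s t) + 2 * c * profile k (s t)) / m := by positivity
      have h1 := hZ' t (hrbo ht) (by linarith)
      have h2 : m * ((δ * profileSlope k (s t) + 2 * c * profile k (s t)) / m)
          = δ * profileSlope k (s t) + 2 * c * profile k (s t) := by field_simp
      have h3 : δ * f t * profileSlope k (s t) ≤ δ * profileSlope k (s t) := by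
        rw [mul_assoc]
        exact mul_le_mul_of_nonneg_left (mul_le_of_le_one_left hD (hf t (hrbo ht)).2) hδ0.le
      rw [mul_sub, h2]
      linarith
    · intro t ht hWt
      have hst := hsr t ⟨ht.1.le, ht.2.le⟩
      have hJ := profile_pos k hst
      have hft := (hf t (hrbo ht)).1
      have h1 := hQ' t (hrbo ht) (by linarith)
      have hGm := gain_mono k hJ.le (show profile k (s t) ≤ Z t by linarith)
      have h3 := subsolution_rate_le hk hc hm hδ0 hδ1 hδE hft hst
      have h4 := mul_le_mul_of_nonneg_left hGm (show 0 ≤ κ * f t by positivity)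
      linarith
  -- `Z` is bounded near `t₁`, the subsolution is not
  obtain ⟨B, hB⟩ := isCompact_Icc.exists_bound_of_continuousOn hZc
  have hlow : ∀ r ∈ Ico 0 t₁, 1 ≤ s r * B := by
    intro r hr
    have h1 := hcomp r hr
    have h2 := (le_abs_self _).trans (hB r ⟨hr.1, hr.2.le.trans ht₁.2⟩)
    have h3 : (s r)⁻¹ ≤ profile k (s r) := by
      have := hspos r hr
      unfold profile
      exact le_add_of_nonneg_right (by positivity)
    have h4 : (s r)⁻¹ ≤ B := by linarith
    rwa [inv_le_iff_one_le_mul₀' (hspos r hr)] at h4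
  have hlim : Tendsto (fun r => s r * B) (𝓝[<] t₁) (𝓝 (s t₁ * B)) := by
    have h1 : ContinuousWithinAt s (Ioo 0 t₁) t₁ :=
      (hsc t₁ ht₁).mono fun r hr => ⟨hr.1.le, hr.2.le.trans ht₁.2⟩
    have h2 : Tendsto s (𝓝[Ioo 0 t₁] t₁) (𝓝 (s t₁)) := h1
    rw [nhdsWithin_Ioo_eq_nhdsLT ht₁0] at h2
    exact h2.mul_const B
  have hfin := ge_of_tendsto hlim (b := 1) (by
    filter_upwards [Ioo_mem_nhdsLT ht₁0] with r hr using hlow r ⟨hr.1.le, hr.2⟩)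
  rw [hs₁, zero_mul] at hfin
  linarith

end DampedEuler

/-! ### The weighted mass and momentum of a solution -/

namespace DampedEuler

open Filter Topology

variable {n : ℕ} {A γ mu lam ρbar : ℝ} {ρ₀ : Space n → ℝ} {u₀ : Space n → Space n} {ε : ℝ}
  {T : ℝ≥0∞} {ρ : ℝ → Space n → ℝ} {u : ℝ → Space n → Space n} {φ : Space n → ℝ} {c R : ℝ}

/-- The excess mass weighted by `φ`. -/
noncomputable def massMoment (ρbar : ℝ) (φ : Space n → ℝ) (r : Space n → ℝ) : ℝ :=
  ∫ x, (r x - ρbar) * φ x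

/-- The momentum weighted by `∇φ`. -/
noncomputable def momentumMoment (φ : Space n → ℝ) (r : Space n → ℝ) (v : Space n → Space n) : ℝ :=
  ∑ i, ∫ x, r x * v x i * partialDeriv i φ x

namespace IsC1Solution

lemma contDiffOn_velocity_coord (sol : IsC1Solution A γ mu lam ρbar ρ₀ u₀ ε T ρ u) (i : Fin n) :
    ContDiffOn ℝ 1 (fun z : ℝ × Space n => u z.1 z.2 i) (timeInterval T ×ˢ univ) :=
  contDiffOn_euclidean.1 sol.velocity_C1 i

lemma contDiffOn_massDensity (sol : IsC1Solution A γ mu lam ρbar ρ₀ u₀ ε T ρ u)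
    (hφ : ContDiff ℝ 1 φ) : ContDiffOn ℝ 1
      (fun z : ℝ × Space n => (ρ z.1 z.2 - ρbar) * φ z.2) (timeInterval T ×ˢ univ) :=
  (sol.density_C1.sub contDiffOn_const).mul (hφ.comp contDiff_snd).contDiffOn

lemma contDiffOn_momentumDensity (sol : IsC1Solution A γ mu lam ρbar ρ₀ u₀ ε T ρ u)
    {ψ : Space n → ℝ} (hψ : ContDiff ℝ 1 ψ) (i : Fin n) : ContDiffOn ℝ 1
      (fun z : ℝ × Space n => ρ z.1 z.2 * u z.1 z.2 i * ψ z.2) (timeInterval T ×ˢ univ) :=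
  (sol.density_C1.mul (sol.contDiffOn_velocity_coord i)).mul (hψ.comp contDiff_snd).contDiffOn

section Moments

variable (sol : IsC1Solution A γ mu lam ρbar ρ₀ u₀ ε T ρ u) (hφ : IsConvexEigenfunction φ)
  (hc : 0 < c)
  (hrest : ∀ t ∈ timeInterval T, ∀ x, R + c * t < ‖x‖ → ρ t x = ρbar ∧ u t x = 0)

include hc hrest in
lemma rest_of_notMem_closedBall {s b : ℝ} (hs : s ∈ timeInterval T) (hsb : s ≤ b) {x : Space n}
    (hx : x ∉ Metric.closedBall (0 : Space n) (R + c * b)) : ρ s x = ρbar ∧ u s x = 0 := by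
  rw [mem_closedBall_zero_iff, not_le] at hx
  exact hrest s hs x (by nlinarith)

include sol hφ hc hrest in
lemma continuousOn_massMoment {b : ℝ} (hb : b ∈ timeInterval T) :
    ContinuousOn (fun t => massMoment ρbar φ (ρ t)) (Icc 0 b) := by
  have hsub : Icc 0 b ⊆ timeInterval T := fun s hs => mem_timeInterval_of_le hb hs.1 hs.2
  refine continuousOn_integral_of_compact_support
    (isCompact_closedBall (0 : Space n) (R + c * b)) ?_ fun s x hs hx => ?_
  · exact (sol.contDiffOn_massDensity hφ.contDiff).continuousOn.mono (prod_mono hsub Subset.rfl)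
  · simp [(rest_of_notMem_closedBall hc hrest (hsub hs) hs.2 hx).1]

include sol hφ hc hrest in
lemma continuousOn_momentumMoment {b : ℝ} (hb : b ∈ timeInterval T) :
    ContinuousOn (fun t => momentumMoment φ (ρ t) (u t)) (Icc 0 b) := by
  have hsub : Icc 0 b ⊆ timeInterval T := fun s hs => mem_timeInterval_of_le hb hs.1 hs.2
  refine continuousOn_finsetSum _ fun i _ => continuousOn_integral_of_compact_support
    (isCompact_closedBall (0 : Space n) (R + c * b)) ?_ fun s x hs hx => ?_
  · exact (sol.contDiffOn_momentumDensity (hφ.contDiff_partialDeriv i) i).continuousOn.mono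
      (prod_mono hsub Subset.rfl)
  · simp [(rest_of_notMem_closedBall hc hrest (hsub hs) hs.2 hx).2]

include sol hφ hc hrest in
/-- The weighted mass balance. -/
lemma hasDerivAt_massMoment {t : ℝ} (ht : t ∈ timeInterval T) (h0 : 0 < t) :
    HasDerivAt (fun s => massMoment ρbar φ (ρ s)) (momentumMoment φ (ρ t) (u t)) t := by
  obtain ⟨b, htb, hb⟩ := exists_gt_mem_timeInterval ht
  have hK := isCompact_closedBall (0 : Space n) (R + c * b)
  have hsub := Ioo_subset_timeInterval hb
  have h1 := hasDerivAt_integral_of_compact (g := fun s x => (ρ s x - ρbar) * φ x)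
    ((sol.contDiffOn_massDensity hφ.contDiff).mono (prod_mono hsub Subset.rfl)) hK
    (fun s hs x hx => by simp [(rest_of_notMem_closedBall hc hrest (hsub hs) hs.2.le hx).1])
    (t := t) ⟨h0, htb⟩
  refine h1.congr_deriv ?_
  have hm : ∀ j, ContDiff ℝ 1 (fun y => ρ t y * u t y j) := fun j =>
    (sol.contDiff_density ht).mul (sol.contDiff_velocity ht j)
  have hms : ∀ j, HasCompactSupport (fun y => ρ t y * u t y j) := fun j =>
    HasCompactSupport.intro hK fun x hx => by
      simp [(rest_of_notMem_closedBall hc hrest ht htb.le hx).2]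
  have hint : ∀ j, Integrable (fun x => partialDeriv j (fun y => ρ t y * u t y j) x * φ x) :=
    fun j => ((continuous_partialDeriv (hm j) j).mul hφ.contDiff.continuous
      ).integrable_of_hasCompactSupport (hasCompactSupport_partialDeriv (hms j) j).mul_right
  have h2 : ∀ x, deriv (fun s => (ρ s x - ρbar) * φ x) t
      = -∑ j, partialDeriv j (fun y => ρ t y * u t y j) x * φ x := by
    intro x
    have hd := (differentiableAt_time sol.density_C1 ht h0 x).hasDerivAt
    rw [((hd.sub_const ρbar).mul_const (φ x)).deriv, ← Finset.sum_mul]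
    have := sol.mass t ht h0 x
    linear_combination φ x * this
  simp only [h2]
  rw [integral_neg, integral_finsetSum _ fun j _ => hint j, ← Finset.sum_neg_distrib,
    momentumMoment]
  exact Finset.sum_congr rfl fun j _ =>
    (integral_mul_partialDeriv (hm j) hφ.contDiff (hms j) j).symm

include sol hφ hc hrest in
/-- The weighted momentum balance. The convexity of `φ` makes the convective term nonnegative, and
`Δφ = φ` turns the linear part of the pressure into `c² X`. -/
lemma exists_hasDerivAt_momentumMoment (hγ : 1 < γ) (hc2 : c ^ 2 = A * γ * ρbar ^ (γ - 1)) {t : ℝ}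
    (ht : t ∈ timeInterval T) (h0 : 0 < t) :
    ∃ D, HasDerivAt (fun s => momentumMoment φ (ρ s) (u s)) D t ∧
      (∫ x, pressureExcess A γ ρbar (ρ t x) * φ x) + c ^ 2 * massMoment ρbar φ (ρ t)
        - mu / (1 + t) ^ lam * momentumMoment φ (ρ t) (u t) ≤ D := by
  obtain ⟨b, htb, hb⟩ := exists_gt_mem_timeInterval ht
  have hK := isCompact_closedBall (0 : Space n) (R + c * b)
  have hsub := Ioo_subset_timeInterval hb
  set a := mu / (1 + t) ^ lam with ha
  have hr : ContDiff ℝ 1 (ρ t) := sol.contDiff_density ht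
  have hu : ∀ i, ContDiff ℝ 1 (fun y => u t y i) := fun i => sol.contDiff_velocity ht i
  have hout : ∀ x, x ∉ Metric.closedBall (0 : Space n) (R + c * b) → ρ t x = ρbar ∧ u t x = 0 :=
    fun x hx => rest_of_notMem_closedBall hc hrest ht htb.le hx
  have hd1 : ∀ i, HasDerivAt (fun s => ∫ x, ρ s x * u s x i * partialDeriv i φ x)
      (∫ x, deriv (fun s => ρ s x * u s x i * partialDeriv i φ x) t) t := fun i =>
    hasDerivAt_integral_of_compact
      ((sol.contDiffOn_momentumDensity (hφ.contDiff_partialDeriv i) i).mono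
        (prod_mono hsub Subset.rfl)) hK
      (fun s hs x hx => by simp [(rest_of_notMem_closedBall hc hrest (hsub hs) hs.2.le hx).2])
      ⟨h0, htb⟩
  have hψ := hφ.contDiff_partialDeriv
  have hφ2 : ∀ i j, Continuous (partialDeriv j (partialDeriv i φ)) := fun i j =>
    continuous_partialDeriv (hψ i) j
  -- the fluxes
  have hF : ∀ i j, ContDiff ℝ 1 (fun y => ρ t y * u t y i * u t y j) := fun i j =>
    (hr.mul (hu i)).mul (hu j)
  have hFs : ∀ i j, HasCompactSupport (fun y => ρ t y * u t y i * u t y j) := fun i j =>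
    HasCompactSupport.intro hK fun x hx => by simp [(hout x hx).2]
  have hp : ContDiff ℝ 1 (fun y => A * ρ t y ^ γ) := (contDiff_pressure hγ).comp hr
  have hP : ContDiff ℝ 1 (fun y => A * ρ t y ^ γ + -(A * ρbar ^ γ)) := hp.add contDiff_const
  have hPs : HasCompactSupport (fun y => A * ρ t y ^ γ + -(A * ρbar ^ γ)) :=
    HasCompactSupport.intro hK fun x hx => by simp [(hout x hx).1]
  have hm : ∀ i, ContDiff ℝ 1 (fun y => ρ t y * u t y i) := fun i => hr.mul (hu i)
  have hms : ∀ i, HasCompactSupport (fun y => ρ t y * u t y i) := fun i =>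
    HasCompactSupport.intro hK fun x hx => by simp [(hout x hx).2]
  have hpP : ∀ i x, partialDeriv i (fun y => A * ρ t y ^ γ) x
      = partialDeriv i (fun y => A * ρ t y ^ γ + -(A * ρbar ^ γ)) x := by
    intro i x
    rw [partialDeriv_add (hp.differentiable one_ne_zero x) (differentiableAt_const _)]
    simp [partialDeriv]
  have h2 : ∀ i x, deriv (fun s => ρ s x * u s x i * partialDeriv i φ x) t
      = -∑ j, partialDeriv j (fun y => ρ t y * u t y i * u t y j) x * partialDeriv i φ x
        - partialDeriv i (fun y => A * ρ t y ^ γ + -(A * ρbar ^ γ)) x * partialDeriv i φ x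
        - a * (ρ t x * u t x i * partialDeriv i φ x) := by
    intro i x
    have hd := (differentiableAt_time sol.density_C1 ht h0 x).mul
      (differentiableAt_euclidean.1 (differentiableAt_time sol.velocity_C1 ht h0 x) i)
    have hd' : HasDerivAt (fun s => ρ s x * u s x i) (deriv (fun s => ρ s x * u s x i) t) t :=
      hd.hasDerivAt
    rw [(hd'.mul_const (partialDeriv i φ x)).deriv, ← Finset.sum_mul, ← hpP]
    have := sol.momentum t ht h0 x i
    linear_combination partialDeriv i φ x * this
  have hI1 : ∀ i j, Integrable (fun x =>
      partialDeriv j (fun y => ρ t y * u t y i * u t y j) x * partialDeriv i φ x) := fun i j =>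
    ((continuous_partialDeriv (hF i j) j).mul (hψ i).continuous).integrable_of_hasCompactSupport
      (hasCompactSupport_partialDeriv (hFs i j) j).mul_right
  have hI2 : ∀ i, Integrable (fun x =>
      partialDeriv i (fun y => A * ρ t y ^ γ + -(A * ρbar ^ γ)) x * partialDeriv i φ x) := fun i =>
    ((continuous_partialDeriv hP i).mul (hψ i).continuous).integrable_of_hasCompactSupport
      (hasCompactSupport_partialDeriv hPs i).mul_right
  have hI3 : ∀ i, Integrable (fun x => ρ t x * u t x i * partialDeriv i φ x) := fun i =>
    ((hm i).continuous.mul (hψ i).continuous).integrable_of_hasCompactSupport (hms i).mul_right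
  have hI4 : ∀ i j, Integrable (fun x =>
      ρ t x * u t x i * u t x j * partialDeriv j (partialDeriv i φ) x) := fun i j =>
    ((hF i j).continuous.mul (hφ2 i j)).integrable_of_hasCompactSupport (hFs i j).mul_right
  have hI5 : ∀ i, Integrable (fun x =>
      (A * ρ t x ^ γ + -(A * ρbar ^ γ)) * partialDeriv i (partialDeriv i φ) x) := fun i =>
    (hP.continuous.mul (hφ2 i i)).integrable_of_hasCompactSupport hPs.mul_right
  have hD : ∀ i, ∫ x, deriv (fun s => ρ s x * u s x i * partialDeriv i φ x) t
      = (∑ j, ∫ x, ρ t x * u t x i * u t x j * partialDeriv j (partialDeriv i φ) x)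
        + (∫ x, (A * ρ t x ^ γ + -(A * ρbar ^ γ)) * partialDeriv i (partialDeriv i φ) x)
        - a * ∫ x, ρ t x * u t x i * partialDeriv i φ x := by
    intro i
    have hS : Integrable (fun x => -∑ j,
        partialDeriv j (fun y => ρ t y * u t y i * u t y j) x * partialDeriv i φ x) :=
      (integrable_finsetSum _ fun j _ => hI1 i j).neg
    simp only [h2]
    rw [integral_sub (by exact hS.sub (hI2 i)) ((hI3 i).const_mul a), integral_sub hS (hI2 i),
      integral_neg, integral_finsetSum _ fun j _ => hI1 i j, integral_const_mul,
      integral_mul_partialDeriv hP (hψ i) hPs i,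
      Finset.sum_congr rfl fun j _ => integral_mul_partialDeriv (hF i j) (hψ i) (hFs i j) j,
      Finset.sum_neg_distrib]
    ring
  refine ⟨_, HasDerivAt.fun_sum fun i _ => hd1 i, ?_⟩
  simp only [hD]
  rw [Finset.sum_sub_distrib, Finset.sum_add_distrib, ← Finset.mul_sum]
  have hconv : 0 ≤ ∑ i, ∑ j,
      ∫ x, ρ t x * u t x i * u t x j * partialDeriv j (partialDeriv i φ) x := by
    have e1 : ∑ i, ∑ j, ∫ x, ρ t x * u t x i * u t x j * partialDeriv j (partialDeriv i φ) x
        = ∫ x, ∑ i, ∑ j, ρ t x * u t x i * u t x j * partialDeriv j (partialDeriv i φ) x := by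
      rw [integral_finsetSum _ fun i _ => integrable_finsetSum _ fun j _ => hI4 i j]
      exact Finset.sum_congr rfl fun i _ => (integral_finsetSum _ fun j _ => hI4 i j).symm
    rw [e1]
    refine integral_nonneg fun x => ?_
    have e2 : ∑ i, ∑ j, ρ t x * u t x i * u t x j * partialDeriv j (partialDeriv i φ) x
        = ρ t x * ∑ i, ∑ j, u t x i * u t x j * partialDeriv j (partialDeriv i φ) x := by
      simp only [Finset.mul_sum]
      exact Finset.sum_congr rfl fun i _ => Finset.sum_congr rfl fun j _ => by ring
    simp only [Pi.zero_apply, e2]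
    exact mul_nonneg (sol.density_nonneg t ht x) (hφ.hessian_nonneg x (u t x))
  have hpres : ∑ i, ∫ x, (A * ρ t x ^ γ + -(A * ρbar ^ γ)) * partialDeriv i (partialDeriv i φ) x
      = (∫ x, pressureExcess A γ ρbar (ρ t x) * φ x) + c ^ 2 * massMoment ρbar φ (ρ t) := by
    rw [← integral_finsetSum _ fun i _ => hI5 i, massMoment, ← integral_const_mul, ← integral_add]
    · refine integral_congr_ae (Eventually.of_forall fun x => ?_)
      simp only
      rw [← Finset.mul_sum, hφ.laplacian, pressureExcess, hc2]
      ring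
    · refine (((contDiff_pressureExcess hγ).continuous.comp hr.continuous).mul
        hφ.contDiff.continuous).integrable_of_hasCompactSupport ?_
      exact HasCompactSupport.intro hK fun x hx => by simp [(hout x hx).1]
    · refine (continuous_const.mul ((hr.continuous.sub continuous_const).mul
        hφ.contDiff.continuous)).integrable_of_hasCompactSupport ?_
      exact HasCompactSupport.intro hK fun x hx => by simp [(hout x hx).1]
  rw [hpres]
  unfold momentumMoment
  linarith

include sol hφ hrest in
/-- Jensen's inequality for the pressure excess and the measure `φ dx` on the support of the
perturbation, of mass at most `V`; it follows from the tangent at the density `ρbar + X / V`. -/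
lemma pressureExcess_jensen (hA : 0 < A) (hγ : 1 < γ) (hρbar : 0 < ρbar) {t : ℝ}
    (ht : t ∈ timeInterval T) {V : ℝ} (hV0 : 0 < V)
    (hV : ∫ x in Metric.closedBall (0 : Space n) (R + c * t), φ x ≤ V)
    (hX : 0 ≤ massMoment ρbar φ (ρ t)) :
    V * pressureExcess A γ ρbar (ρbar + massMoment ρbar φ (ρ t) / V)
      ≤ ∫ x, pressureExcess A γ ρbar (ρ t x) * φ x := by
  set X := massMoment ρbar φ (ρ t) with hXdef
  set B := Metric.closedBall (0 : Space n) (R + c * t) with hB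
  have hBc : IsCompact B := isCompact_closedBall _ _
  have hout : ∀ x, x ∉ B → ρ t x = ρbar := by
    intro x hx
    rw [hB, mem_closedBall_zero_iff, not_le] at hx
    exact (hrest t ht x hx).1
  set s := X / V with hs
  have hs0 : 0 ≤ s := div_nonneg hX hV0.le
  have hsV : s * V = X := div_mul_cancel₀ _ hV0.ne'
  set P := pressureExcess A γ ρbar (ρbar + s) with hP
  set P' := A * γ * (ρbar + s) ^ (γ - 1) - A * γ * ρbar ^ (γ - 1) with hP'
  have hr := (sol.contDiff_density ht).continuous
  have hφc := hφ.contDiff.continuous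
  have hneg : P - P' * s ≤ 0 := by
    have h := tangent_le_pressureExcess (ρbar := ρbar) hA hγ (a := ρbar + s) (ρ := ρbar)
      (by linarith) hρbar.le
    rw [pressureExcess_self] at h
    linarith
  have e1 : ∫ x, pressureExcess A γ ρbar (ρ t x) * φ x
      = ∫ x in B, pressureExcess A γ ρbar (ρ t x) * φ x :=
    (setIntegral_eq_integral_of_forall_compl_eq_zero fun x hx => by simp [hout x hx]).symm
  have e2 : X = ∫ x in B, (ρ t x - ρbar) * φ x :=
    (setIntegral_eq_integral_of_forall_compl_eq_zero fun x hx => by simp [hout x hx]).symm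
  have i1 : IntegrableOn φ B := hφc.continuousOn.integrableOn_compact hBc
  have i2 : IntegrableOn (fun x => (ρ t x - ρbar) * φ x) B :=
    ((hr.sub continuous_const).mul hφc).continuousOn.integrableOn_compact hBc
  have i3 : IntegrableOn (fun x => pressureExcess A γ ρbar (ρ t x) * φ x) B :=
    (((contDiff_pressureExcess hγ).continuous.comp hr).mul
      hφc).continuousOn.integrableOn_compact hBc
  have e3 : ∫ x in B, ((P - P' * s) * φ x + P' * ((ρ t x - ρbar) * φ x))
      = (P - P' * s) * (∫ x in B, φ x) + P' * X := by
    rw [integral_add (i1.const_mul _) (i2.const_mul _), integral_const_mul, integral_const_mul, e2]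
  have e4 : ∫ x in B, ((P - P' * s) * φ x + P' * ((ρ t x - ρbar) * φ x))
      ≤ ∫ x in B, pressureExcess A γ ρbar (ρ t x) * φ x := by
    refine setIntegral_mono ((i1.const_mul _).add (i2.const_mul _)) i3 fun x => ?_
    have h := tangent_le_pressureExcess (ρbar := ρbar) hA hγ (a := ρbar + s) (ρ := ρ t x)
      (by linarith) (sol.density_nonneg t ht x)
    have h' := mul_le_mul_of_nonneg_right h (hφ.nonneg x)
    simp only
    linarith
  have e5 := mul_le_mul_of_nonpos_left hV hneg
  have e6 : (P - P' * s) * V + P' * X = V * P := by rw [← hsV]; ring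
  rw [e1]
  linarith

end Moments

end IsC1Solution

end DampedEuler

/-! ### Lifespan estimates -/

namespace DampedEuler

open Filter Topology

variable {n : ℕ}

/-- The integral `∫₀ᵗ mu / (1 + s)^lam ds` of the damping coefficient. -/
noncomputable def dampingIntegral (mu lam t : ℝ) : ℝ :=
  mu / (lam - 1) * (1 - (1 + t) ^ (1 - lam))

lemma hasDerivAt_dampingIntegral {mu lam t : ℝ} (hlam : 1 < lam) (ht : 0 ≤ t) :
    HasDerivAt (dampingIntegral mu lam) (mu / (1 + t) ^ lam) t := by
  have h0 : 0 < 1 + t := by linarith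
  have h1 := (((((hasDerivAt_id t).const_add 1).rpow_const (p := 1 - lam)
    (Or.inl h0.ne')).const_sub 1).const_mul (mu / (lam - 1)))
  refine h1.congr_deriv ?_
  have h2 : (1 : ℝ) - lam - 1 = -lam := by ring
  have h3 : lam - 1 ≠ 0 := by linarith
  simp only [id, h2, Real.rpow_neg h0.le]
  field_simp
  ring

lemma dampingIntegral_nonneg {mu lam t : ℝ} (hmu : 0 ≤ mu) (hlam : 1 < lam) (ht : 0 ≤ t) :
    0 ≤ dampingIntegral mu lam t := by
  have h1 : (1 + t) ^ (1 - lam) ≤ 1 :=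
    Real.rpow_le_one_of_one_le_of_nonpos (by linarith) (by linarith)
  exact mul_nonneg (div_nonneg hmu (by linarith)) (by linarith)

lemma dampingIntegral_le {mu lam t : ℝ} (hmu : 0 ≤ mu) (hlam : 1 < lam) (ht : 0 ≤ t) :
    dampingIntegral mu lam t ≤ mu / (lam - 1) := by
  have h1 : 0 ≤ (1 + t) ^ (1 - lam) := Real.rpow_nonneg (by linarith) _
  exact mul_le_of_le_one_right (div_nonneg hmu (by linarith)) (by linarith)

lemma inner_gradient_eq_sum (f : Space n → ℝ) (x v : Space n) :
    inner ℝ v (gradient f x) = ∑ i, v i * partialDeriv i f x := by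
  rw [real_inner_comm, gradient, InnerProductSpace.toDual_symm_apply, fderiv_eq_sum_partialDeriv]

lemma exists_data_radius {ρ₀ : Space n → ℝ} {u₀ : Space n → Space n}
    (hρ₀c : HasCompactSupport ρ₀) (hu₀c : HasCompactSupport u₀) :
    ∃ R > 0, ∀ x, R < ‖x‖ → ρ₀ x = 0 ∧ u₀ x = 0 := by
  obtain ⟨R, hR⟩ := (hρ₀c.isCompact.isBounded.union hu₀c.isCompact.isBounded).subset_closedBall
    (0 : Space n)
  refine ⟨max R 1, by positivity, fun x hx => ?_⟩
  have h1 : x ∉ tsupport ρ₀ ∪ tsupport u₀ := fun h => by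
    have h2 := hR h
    rw [mem_closedBall_zero_iff] at h2
    linarith [le_max_left R 1]
  exact ⟨image_eq_zero_of_notMem_tsupport fun h => h1 (Or.inl h),
    image_eq_zero_of_notMem_tsupport fun h => h1 (Or.inr h)⟩

lemma momentumMoment_data {ρ₀ φ : Space n → ℝ} {u₀ : Space n → Space n} (hρ₀ : Continuous ρ₀)
    (hu₀ : Continuous u₀) (hu₀c : HasCompactSupport u₀)
    (hφ : ∀ i, Continuous (partialDeriv i φ)) (ρbar ε : ℝ) :
    momentumMoment φ (fun x => ρbar + ε * ρ₀ x) (fun x => ε • u₀ x)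
      = ε * (ρbar * (∫ x, inner ℝ (u₀ x) (gradient φ x)) + ε * momentumMoment φ ρ₀ u₀) := by
  have hui : ∀ i, Continuous (fun x => u₀ x i) := fun i =>
    (EuclideanSpace.proj (𝕜 := ℝ) i).continuous.comp hu₀
  have huc : ∀ i, HasCompactSupport (fun x => u₀ x i) := fun i =>
    hu₀c.comp_left (g := fun v : Space n => v i) (by simp)
  have h1 : ∀ i, Integrable (fun x => u₀ x i * partialDeriv i φ x) := fun i =>
    ((hui i).mul (hφ i)).integrable_of_hasCompactSupport (huc i).mul_right
  have h2 : ∀ i, Integrable (fun x => ρ₀ x * u₀ x i * partialDeriv i φ x) := fun i =>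
    ((hρ₀.mul (hui i)).mul (hφ i)).integrable_of_hasCompactSupport (huc i).mul_left.mul_right
  simp only [inner_gradient_eq_sum]
  rw [integral_finsetSum _ fun i _ => h1 i, momentumMoment, momentumMoment, Finset.mul_sum,
    Finset.mul_sum, ← Finset.sum_add_distrib, Finset.mul_sum]
  refine Finset.sum_congr rfl fun i _ => ?_
  rw [← integral_const_mul, ← integral_const_mul, ← integral_add ((h1 i).const_mul _)
    ((h2 i).const_mul _), ← integral_const_mul]
  refine integral_congr_ae (Eventually.of_forall fun x => ?_)
  simp only [PiLp.smul_apply, smul_eq_mul]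
  ring

/-- A uniform bound for the lifespan, in terms of the primitive `τ` of `(1 + t)^(-(n-1)/2)`: the
solution stops before `τ` reaches `C / ε`. -/
theorem exists_lifespan_const (hn : 1 ≤ n) {A γ mu lam ρbar : ℝ} (hA : 0 < A) (hγ : 1 < γ)
    (hmu : 0 ≤ mu) (hlam : 1 < lam) (hρbar : 0 < ρbar) {ρ₀ : Space n → ℝ}
    {u₀ : Space n → Space n} (hρ₀ : Continuous ρ₀) (hρ₀c : HasCompactSupport ρ₀)
    (hu₀ : Continuous u₀) (hu₀c : HasCompactSupport u₀) {φ : Space n → ℝ}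
    (hφ : IsConvexEigenfunction φ) (hρ₀φ : 0 < ∫ x, ρ₀ x * φ x)
    (hu₀φ : 0 < ∫ x, inner ℝ (u₀ x) (gradient φ x)) :
    ∃ ε₀ > 0, ε₀ ≤ 1 ∧ ∃ C > 0, ∀ ε, 0 < ε → ε ≤ ε₀ → ∀ (T : ℝ≥0∞) (ρ : ℝ → Space n → ℝ)
      (u : ℝ → Space n → Space n), IsC1Solution A γ mu lam ρbar ρ₀ u₀ ε T ρ u →
      ∀ (τ : ℝ → ℝ) (b : ℝ), 0 ≤ b →
        (∀ t, 0 ≤ t → HasDerivAt τ ((1 + t) ^ (-(((n : ℝ) - 1) / 2))) t) → τ 0 = 0 →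
        C / ε ≤ τ b → T ≤ ENNReal.ofReal b := by
  obtain ⟨R, hR, hdata⟩ := exists_data_radius hρ₀c hu₀c
  set c : ℝ := Real.sqrt (A * γ * ρbar ^ (γ - 1)) with hcdef
  have hcp : 0 < A * γ * ρbar ^ (γ - 1) := by positivity
  have hc : 0 < c := Real.sqrt_pos.2 hcp
  have hc2 : c ^ 2 = A * γ * ρbar ^ (γ - 1) := Real.sq_sqrt hcp.le
  obtain ⟨k, hk, hkγ⟩ : ∃ k : ℕ, 1 ≤ k ∧ 1 / (k : ℝ) ≤ γ - 1 := by
    obtain ⟨k, hk⟩ := exists_nat_gt (1 / (γ - 1))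
    have hk0 : (0 : ℝ) < k := lt_trans (by have : 0 < γ - 1 := by linarith
                                           positivity) hk
    refine ⟨k, by exact_mod_cast hk0, ?_⟩
    rw [div_le_iff₀ hk0]
    rw [div_lt_iff₀ (by linarith)] at hk
    linarith
  obtain ⟨K, hK, hgain⟩ := exists_gain_le_pressureExcess hA hγ hρbar hk hkγ
  obtain ⟨V₁, hV₁, hball⟩ := hφ.ball_bound R c hR hc
  have hV₁0 : 0 < V₁ := by linarith
  set a₀ : ℝ := mu / (lam - 1) with ha₀
  obtain ⟨C, hC, hblow⟩ := exists_blowup_const hk hc (Real.exp_pos (-a₀))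
    (show 0 < K / V₁ by positivity) hρ₀φ
  set I := ∫ x, inner ℝ (u₀ x) (gradient φ x) with hI
  set J := momentumMoment φ ρ₀ u₀ with hJ
  refine ⟨min 1 (ρbar * I / (|J| + 1)), lt_min one_pos (by positivity), min_le_left _ _, C, hC, ?_⟩
  intro ε hε hε₀ T ρ u sol τ b hb hτ hτ0 hτb
  by_contra hT
  have hbT : b ∈ timeInterval T := ⟨hb, not_le.1 hT⟩
  have hrest : ∀ t ∈ timeInterval T, ∀ x, R + c * t < ‖x‖ → ρ t x = ρbar ∧ u t x = 0 :=
    fun t ht x hx => sol.finite_speed hA hγ hρbar hmu hc hc2 hdata ht hx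
  have hsub : ∀ t ∈ Ioo 0 b, t ∈ timeInterval T := Ioo_subset_timeInterval hbT
  set α : ℝ := ((n : ℝ) - 1) / 2 with hα
  have hα0 : 0 ≤ α := by
    have : (1 : ℝ) ≤ n := by exact_mod_cast hn
    rw [hα]; linarith
  set X : ℝ → ℝ := fun t => massMoment ρbar φ (ρ t) with hX
  set M : ℝ → ℝ := fun t => momentumMoment φ (ρ t) (u t) with hM
  have hXd : ∀ t ∈ Ioo 0 b, HasDerivAt X (M t) t := fun t ht =>
    sol.hasDerivAt_massMoment hφ hc hrest (hsub t ht) ht.1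
  have hMd : ∀ t ∈ Ioo 0 b, HasDerivAt M (deriv M t) t ∧
      (∫ x, pressureExcess A γ ρbar (ρ t x) * φ x) + c ^ 2 * X t - mu / (1 + t) ^ lam * M t
        ≤ deriv M t := by
    intro t ht
    obtain ⟨D, hD, hle⟩ := sol.exists_hasDerivAt_momentumMoment hφ hc hrest hγ hc2 (hsub t ht) ht.1
    have hD' : HasDerivAt M D t := hD
    rw [hD'.deriv]
    exact ⟨hD', hle⟩
  set d : ℝ → ℝ := dampingIntegral mu lam with hd
  have hexp : ∀ t, HasDerivAt (fun t => Real.exp (-(c * t))) (Real.exp (-(c * t)) * -c) t := by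
    intro t
    simpa using ((hasDerivAt_id t).const_mul c).neg.exp
  have hexpd : ∀ t, 0 ≤ t → HasDerivAt (fun t => Real.exp (-(c * t) + d t))
      (Real.exp (-(c * t) + d t) * (-c + mu / (1 + t) ^ lam)) t := by
    intro t ht
    have := (((hasDerivAt_id t).const_mul c).neg.add (hasDerivAt_dampingIntegral (mu := mu)
      hlam ht)).exp
    simpa using this
  have hdc : ContinuousOn d (Icc 0 b) := fun t ht =>
    (hasDerivAt_dampingIntegral hlam ht.1).continuousAt.continuousWithinAt
  have hXc : ContinuousOn X (Icc 0 b) := sol.continuousOn_massMoment hφ hc hrest hbT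
  have hMc : ContinuousOn M (Icc 0 b) := sol.continuousOn_momentumMoment hφ hc hrest hbT
  have hX0 : X 0 = (∫ x, ρ₀ x * φ x) * ε := by
    simp only [hX, massMoment, sol.density_init, add_sub_cancel_left, mul_assoc]
    rw [integral_const_mul, mul_comm]
  have hM0 : 0 ≤ M 0 := by
    have e1 : M 0 = ε * (ρbar * I + ε * J) := by
      rw [hI, hJ, ← momentumMoment_data hρ₀ hu₀ hu₀c
        (fun i => (hφ.contDiff_partialDeriv i).continuous)]
      simp only [hM]
      rw [show ρ 0 = fun x => ρbar + ε * ρ₀ x from funext sol.density_init,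
        show u 0 = fun x => ε • u₀ x from funext sol.velocity_init]
    have e2 : ε * (|J| + 1) ≤ ρbar * I := by
      have := hε₀.trans (min_le_right _ _)
      rwa [le_div_iff₀ (by positivity)] at this
    rw [e1]
    refine mul_nonneg hε.le ?_
    nlinarith [neg_abs_le J]
  refine hblow ε hε (hε₀.trans (min_le_left _ _)) (fun t => (1 + t) ^ (-α)) τ
    (fun t => Real.exp (-(c * t)) * X t) (fun t => Real.exp (-(c * t) + d t) * (M t + c * X t))
    (fun t => Real.exp (-(c * t)) * (M t - c * X t))
    (fun t => Real.exp (-(c * t) + d t) * ((-c + mu / (1 + t) ^ lam) * (M t + c * X t)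
      + (deriv M t + c * M t))) b hb
    ?_ (fun t ht => hτ t ht.1.le) (fun t ht => (hτ t ht.1).continuousAt.continuousWithinAt) hτ0 hτb
    ((Continuous.continuousOn (by fun_prop)).mul hXc)
    (((Continuous.continuousOn (by fun_prop)).add hdc).rexp.mul
      (hMc.add (continuousOn_const.mul hXc))) ?_ ?_ ?_ ?_ ?_ ?_
  · intro t ht
    have h1 : 1 ≤ 1 + t := by linarith [ht.1]
    exact ⟨Real.rpow_pos_of_pos (by linarith) _,
      Real.rpow_le_one_of_one_le_of_nonpos h1 (by linarith)⟩
  · intro t ht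
    refine ((hexp t).mul (hXd t ht)).congr_deriv ?_
    ring
  · intro t ht
    refine ((hexpd t ht.1.le).mul ((hMd t ht).1.fun_add ((hXd t ht).const_mul c))).congr_deriv ?_
    ring
  · intro t ht hQ
    have e1 : Real.exp (-a₀) * (Real.exp (-(c * t) + d t) * (M t + c * X t))
        ≤ Real.exp (-d t) * (Real.exp (-(c * t) + d t) * (M t + c * X t)) := by
      refine mul_le_mul_of_nonneg_right (Real.exp_le_exp.2 ?_) hQ
      have := dampingIntegral_le hmu hlam ht.1.le
      linarith
    have e2 : Real.exp (-d t) * (Real.exp (-(c * t) + d t) * (M t + c * X t))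
        = Real.exp (-(c * t)) * (M t + c * X t) := by
      rw [← mul_assoc, ← Real.exp_add]
      congr 2
      ring
    linarith
  · intro t ht hZ
    have hXt : 0 ≤ X t := nonneg_of_mul_nonneg_right hZ (Real.exp_pos _)
    have ht0 : 0 < 1 + t := by linarith [ht.1]
    set f : ℝ := (1 + t) ^ (-α) with hf
    have hf0 : 0 < f := Real.rpow_pos_of_pos ht0 _
    have hf1 : f ≤ 1 := Real.rpow_le_one_of_one_le_of_nonpos (by linarith [ht.1]) (by linarith)
    set e : ℝ := Real.exp (-(c * t)) with he
    have he0 : 0 < e := Real.exp_pos _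
    have hV : V₁ * Real.exp (c * t) * (1 + t) ^ α = V₁ / (e * f) := by
      rw [he, hf, Real.exp_neg, Real.rpow_neg ht0.le]
      field_simp
    have hballt := hball t ht.1.le
    rw [hV] at hballt
    have hjen := sol.pressureExcess_jensen hφ hrest hA hγ hρbar (hsub t ht)
      (show 0 < V₁ / (e * f) by positivity) hballt hXt
    set N := ∫ x, pressureExcess A γ ρbar (ρ t x) * φ x with hN
    have h1 : massMoment ρbar φ (ρ t) / (V₁ / (e * f)) = f / V₁ * (e * X t) := by
      simp only [hX]; field_simp
    rw [h1] at hjen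
    have hZ' : 0 ≤ e * X t := hZ
    have h2 := hgain (f / V₁ * (e * X t)) (by positivity)
    have h3 := sq_mul_gain_le hk (κ := f / V₁) (by positivity)
      (by rw [div_le_one hV₁0]; linarith) hZ'
    have h4 : V₁ / (e * f) * (K * ((f / V₁) ^ 2 * gain k (e * X t))) ≤ N :=
      (mul_le_mul_of_nonneg_left ((mul_le_mul_of_nonneg_left h3 hK.le).trans h2)
        (by positivity)).trans hjen
    have h5 : V₁ / (e * f) * (K * ((f / V₁) ^ 2 * gain k (e * X t)))
        = K / V₁ * f * gain k (e * X t) / e := by field_simp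
    rw [h5, div_le_iff₀ he0] at h4
    have hN0 : 0 ≤ N := by
      have h6 : 0 ≤ K / V₁ * f * gain k (e * X t) :=
        mul_nonneg (by positivity) (gain_nonneg k hZ')
      exact nonneg_of_mul_nonneg_left (h6.trans h4) he0
    have hexpge : e ≤ Real.exp (-(c * t) + d t) := by
      refine Real.exp_le_exp.2 ?_
      linarith [dampingIntegral_nonneg hmu hlam ht.1.le]
    have ha : 0 ≤ mu / (1 + t) ^ lam := div_nonneg hmu (Real.rpow_nonneg ht0.le _)
    have h7 : N ≤ (-c + mu / (1 + t) ^ lam) * (M t + c * X t) + (deriv M t + c * M t) := by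
      have h8 := (hMd t ht).2
      have h9 : 0 ≤ mu / (1 + t) ^ lam * (c * X t) := by positivity
      linarith
    calc K / V₁ * f * gain k (e * X t) ≤ N * e := h4
      _ = e * N := mul_comm _ _
      _ ≤ Real.exp (-(c * t) + d t) * N := mul_le_mul_of_nonneg_right hexpge hN0
      _ ≤ _ := mul_le_mul_of_nonneg_left h7 (Real.exp_pos _).le
  · simp [hX0]
  · have hd0 : d 0 = 0 := by simp [hd, dampingIntegral]
    simp only [mul_zero, neg_zero, hd0, add_zero, Real.exp_zero, one_mul, hX0]
    linarith

end DampedEuler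

theorem theorem1 (n : ℕ) (hn : n = 1 ∨ n = 2 ∨ n = 3)
    (A γ mu lam ρbar : ℝ) (hA : 0 < A) (hγ : 1 < γ) (hmu : 0 ≤ mu) (hlam : 1 < lam)
    (hρbar : 0 < ρbar)
    (ρ₀ : DampedEuler.Space n → ℝ) (u₀ : DampedEuler.Space n → DampedEuler.Space n)
    (hρ₀ : ContDiff ℝ ∞ ρ₀) (hρ₀c : HasCompactSupport ρ₀)
    (hu₀ : ContDiff ℝ ∞ u₀) (hu₀c : HasCompactSupport u₀)
    (hρ₀φ : 0 < ∫ x, ρ₀ x * DampedEuler.phi n x)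
    (hu₀φ : 0 < ∫ x, inner ℝ (u₀ x) (gradient (DampedEuler.phi n) x)) :
    ∃ ε₀ : ℝ, 0 < ε₀ ∧ ∃ C : ℝ, 0 < C ∧ ∀ ε : ℝ, 0 < ε → ε ≤ ε₀ →
      (¬ ∃ (ρ : ℝ → DampedEuler.Space n → ℝ)
          (u : ℝ → DampedEuler.Space n → DampedEuler.Space n),
          DampedEuler.IsC1Solution A γ mu lam ρbar ρ₀ u₀ ε ⊤ ρ u) ∧
      (n = 1 ∨ n = 2 →
        DampedEuler.lifespan A γ mu lam ρbar ρ₀ u₀ ε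
          ≤ ENNReal.ofReal (C * ε ^ (-(2 / (3 - (n : ℝ)))))) ∧
      (n = 3 →
        DampedEuler.lifespan A γ mu lam ρbar ρ₀ u₀ ε
          ≤ ENNReal.ofReal (Real.exp (C * ε⁻¹))) := by
  have hn1 : 1 ≤ n := by omega
  obtain ⟨ε₀, hε₀, hε₁, C, hC, hmain⟩ := DampedEuler.exists_lifespan_const hn1 hA hγ hmu hlam hρbar
    hρ₀.continuous hρ₀c hu₀.continuous hu₀c (DampedEuler.isConvexEigenfunction_phi hn1) hρ₀φ hu₀φ
  -- `(1 + C / (2 ε))² ≤ 1 + (C + C² / 4) / ε²` for `ε ≤ 1` dictates the constant when `n = 2`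
  refine ⟨ε₀, hε₀, C + C ^ 2 / 4, by positivity, fun ε hε hεε₀ => ?_⟩
  have hCC : C ≤ C + C ^ 2 / 4 := le_add_of_nonneg_right (by positivity)
  have hε1 : ε ≤ 1 := hεε₀.trans hε₁
  have hpos : ∀ t : ℝ, 0 ≤ t → 0 < 1 + t := fun t ht => by linarith
  have hbound : ∀ (τ : ℝ → ℝ) (b : ℝ), 0 ≤ b →
      (∀ t, 0 ≤ t → HasDerivAt τ ((1 + t) ^ (-(((n : ℝ) - 1) / 2))) t) → τ 0 = 0 →
      C / ε ≤ τ b →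
      (¬ ∃ (ρ : ℝ → DampedEuler.Space n → ℝ)
          (u : ℝ → DampedEuler.Space n → DampedEuler.Space n),
          DampedEuler.IsC1Solution A γ mu lam ρbar ρ₀ u₀ ε ⊤ ρ u) ∧
      DampedEuler.lifespan A γ mu lam ρbar ρ₀ u₀ ε ≤ ENNReal.ofReal b := by
    intro τ b hb hτ hτ0 hτb
    constructor
    · rintro ⟨ρ, u, sol⟩
      exact absurd (hmain ε hε hεε₀ ⊤ ρ u sol τ b hb hτ hτ0 hτb) (by simp)
    · refine sSup_le ?_
      rintro T ⟨ρ, u, sol⟩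
      exact hmain ε hε hεε₀ T ρ u sol τ b hb hτ hτ0 hτb
  rcases hn with rfl | rfl | rfl
  · obtain ⟨h1, h2⟩ := hbound (fun t => t) ((C + C ^ 2 / 4) * ε ^ (-(2 / (3 - ((1 : ℕ) : ℝ)))))
      (by positivity) (fun t _ => by simpa using hasDerivAt_id' t) rfl (by
        have e1 : -(2 / (3 - ((1 : ℕ) : ℝ))) = -1 := by norm_num
        rw [e1, Real.rpow_neg_one, div_eq_mul_inv]
        gcongr)
    exact ⟨h1, fun _ => h2, fun h => by omega⟩
  · obtain ⟨h1, h2⟩ := hbound (fun t => 2 * (Real.sqrt (1 + t) - 1))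
      ((C + C ^ 2 / 4) * ε ^ (-(2 / (3 - ((2 : ℕ) : ℝ)))))
      (by positivity) (fun t ht => by
        have e1 := ((((hasDerivAt_id t).const_add 1).sqrt (hpos t ht).ne').sub_const 1).const_mul 2
        refine e1.congr_deriv ?_
        have e2 : (-((((2 : ℕ) : ℝ) - 1) / 2)) = -(1 / 2) := by norm_num
        rw [e2, Real.rpow_neg (hpos t ht).le, ← Real.sqrt_eq_rpow]
        simp only [id]
        field_simp) (by simp) (by
        have e1 : -(2 / (3 - ((2 : ℕ) : ℝ))) = -((2 : ℕ) : ℝ) := by norm_num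
        rw [e1, Real.rpow_neg hε.le, Real.rpow_natCast]
        have e2 : 1 + C / ε / 2
            ≤ Real.sqrt (1 + (C + C ^ 2 / 4) * (ε ^ 2)⁻¹) := by
          refine Real.le_sqrt_of_sq_le ?_
          have e3 : C / ε ≤ C * (ε ^ 2)⁻¹ := by
            rw [div_eq_mul_inv]
            refine mul_le_mul_of_nonneg_left (inv_anti₀ (by positivity) ?_) hC.le
            nlinarith
          have e4 : (1 + C / ε / 2) ^ 2 = 1 + C / ε + C ^ 2 / 4 * (ε ^ 2)⁻¹ := by
            field_simp; ring
          rw [e4]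
          linarith
        linarith)
    exact ⟨h1, fun _ => h2, fun h => by omega⟩
  · obtain ⟨h1, h2⟩ := hbound (fun t => Real.log (1 + t)) (Real.exp ((C + C ^ 2 / 4) * ε⁻¹))
      (by positivity) (fun t ht => by
        have e1 := ((hasDerivAt_id t).const_add 1).log (hpos t ht).ne'
        refine e1.congr_deriv ?_
        have e2 : (-((((3 : ℕ) : ℝ) - 1) / 2)) = -1 := by norm_num
        rw [e2, Real.rpow_neg_one, id, one_div]) (by simp) (by
        have e1 : C / ε ≤ (C + C ^ 2 / 4) * ε⁻¹ := by
          rw [div_eq_mul_inv]; gcongr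
        refine e1.trans ?_
        rw [Real.le_log_iff_exp_le (by positivity)]
        linarith)
    exact ⟨h1, fun h => by omega, fun _ => h2⟩
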